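/- Let $a>b>0$, $c^2=a^2-b^2$, let $\mathcal E$ be the ellipse $x^2/a^2+y^2/b^2=1$, and put $$a_\triangle=\frac{a\,c^2}{a^2+3b^2},\qquad b_\triangle=\frac{b\,c^2}{3a^2+b^2}.$$ For a triangle with sidelengths $l_1,l_2,l_3$ let $X_5$ be the centre of its Euler (nine-point) circle. For a non-equilateral triangle let $X_{11}$ be its Feuerbach point, with barycentric coordinates $[(l_2+l_3-l_1)(l_2-l_3)^2:(l_3+l_1-l_2)(l_3-l_1)^2:(l_1+l_2-l_3)(l_1-l_2)^2]$, and let $X_{80}$ be the reflection of the incenter in $X_{11}$. (Both are undefined for an equilateral triangle.) (i) The locus $\mathcal E_\triangle$ of the centroids of the equilateral triangles inscribed in $\mathcal E$ is the ellipse $\{[a_\triangle\cos t,\,b_\triangle\sin t] : t\in\mathbb R\}$. (ii) Let $C=[a_\triangle\cos t,\,b_\triangle\sin t]$ be a point of $\mathcal E_\triangle$. There is a circle $\mathcal K$ centered at $C$ such that every point of $\mathcal E$ is a vertex of a triangle inscribed in $\mathcal E$ with incircle $\mathcal K$. For any such circle $\mathcal K$, let $\mathcal T_\triangle$ be the (Poncelet)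 family of all triangles inscribed in $\mathcal E$ whose incircle is $\mathcal K$. Then $\mathcal T_\triangle$ contains an equilateral triangle, and over all non-equilateral triangles of $\mathcal T_\triangle$ the points $X_{11}$ and $X_{80}$ are stationary, at $$X_{11}=\frac{a^2+b^2}{c^2}\,[a_\triangle\cos t,\,-b_\triangle\sin t],\qquad X_{80}=[a\cos t,\,-b\sin t].$$ The first of these two points lies on $\mathcal K$, the second on $\mathcal E$. Moreover the locus of $X_5$ over $\mathcal T_\triangle$ is a nondegenerate segment with one endpoint at $C$, and these two points are the intersections of $\mathcal K$, respectively of $\mathcal E$, with the extension of this segment beyond $C$. -/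

import Mathlib

noncomputable section

/-- The Euclidean plane. -/
abbrev Plane : Type := EuclideanSpace ℝ (Fin 2)

/-- Nondegenerate triangles in the Euclidean plane. -/
abbrev PlaneTriangle : Type := Affine.Triangle ℝ Plane

/-- The ellipse (as a curve) with semi-axes `a`, `b`, centred at the origin, axis-aligned. -/
def ellipse (a b : ℝ) : Set Plane := {p | p 0 ^ 2 / a ^ 2 + p 1 ^ 2 / b ^ 2 = 1}

/-- The triangle `T` is inscribed in the ellipse. -/
def InscribedInEllipse (a b : ℝ) (T : PlaneTriangle) : Prop :=
  ∀ i, T.points i ∈ ellipse a b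

/-- The locus of the centroids of the equilateral triangles inscribed in the ellipse. -/
def equilateralCentroidLocus (a b : ℝ) : Set Plane :=
  {p | ∃ T : PlaneTriangle, InscribedInEllipse a b T ∧ T.Equilateral ∧ T.centroid = p}

/-- The first semi-axis `a c² / (a² + 3 b²)`, where `c² = a² - b²`. -/
def aTri (a b : ℝ) : ℝ := a * (a ^ 2 - b ^ 2) / (a ^ 2 + 3 * b ^ 2)

/-- The second semi-axis `b c² / (3 a² + b²)`, where `c² = a² - b²`. -/
def bTri (a b : ℝ) : ℝ := b * (a ^ 2 - b ^ 2) / (3 * a ^ 2 + b ^ 2)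

/-- The triangles inscribed in the ellipse whose incircle is the circle with centre `C`
and radius `r`. -/
def interscribed (a b : ℝ) (C : Plane) (r : ℝ) : Set PlaneTriangle :=
  {T | InscribedInEllipse a b T ∧ T.incenter = C ∧ T.inradius = r}

/-- The circle with centre `C` and radius `r` is the caustic of a Poncelet family of triangles
inscribed in the ellipse: every point of the ellipse is a vertex of a triangle which is inscribed
in the ellipse and has that circle as its incircle. -/
def IsPonceletIncircle (a b : ℝ) (C : Plane) (r : ℝ) : Prop :=
  ∀ V ∈ ellipse a b, ∃ T ∈ interscribed a b C r, ∃ i, T.points i = V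

/-- The point with (unnormalised) barycentric coordinates `[w₁ : w₂ : w₃]` with respect to `T`
(meaningful when `w₁ + w₂ + w₃ ≠ 0`). -/
def baryPoint (T : PlaneTriangle) (w₁ w₂ w₃ : ℝ) : Plane :=
  (w₁ + w₂ + w₃)⁻¹ • (w₁ • T.points 0 + w₂ • T.points 1 + w₃ • T.points 2)

/-- The Euler centre `X₅`: the centre of the Euler (nine-point) circle. -/
def eulerCenter (T : PlaneTriangle) : Plane := T.ninePointCircle.center

/-- The Feuerbach point `X₁₁`, with barycentric coordinates
`(l₂ + l₃ - l₁)(l₂ - l₃)² ::`, where `l₁, l₂, l₃` are the sidelengths. The coordinates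
have sum `0` only when the triangle is equilateral, where `X₁₁` is undefined. -/
def feuerbachPoint (T : PlaneTriangle) : Plane :=
  let l₁ := dist (T.points 1) (T.points 2)
  let l₂ := dist (T.points 2) (T.points 0)
  let l₃ := dist (T.points 0) (T.points 1)
  baryPoint T ((l₂ + l₃ - l₁) * (l₂ - l₃) ^ 2) ((l₃ + l₁ - l₂) * (l₃ - l₁) ^ 2)
    ((l₁ + l₂ - l₃) * (l₁ - l₂) ^ 2)

/-- The triangle centre `X₈₀`: the reflection of the incenter in the Feuerbach point. -/
def centerX80 (T : PlaneTriangle) : Plane :=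
  AffineEquiv.pointReflection ℝ (feuerbachPoint T) T.incenter

end

/-! Dividing the coordinates by `a` and `b` turns the ellipse into the unit circle of `ℂ`, and the
circle of radius `r` about the image of `m` into an ellipse with foci `f, g = m ± iρ`, where `ρ ^ 2
= r ^ 2 * (1 / b ^ 2 - 1 / a ^ 2)`. The sides of a triangle `u v w` inscribed in the unit circle
touch this caustic exactly when a Cayley condition on `m` and `r` holds and `u, v, w` are the roots
of the Blaschke equation `z (z - f) (z - g) = l (1 - f̄ z) (1 - ḡ z)` with `l = u v w`
(`vieta_of_tangent`, `tangent_of_vieta`). For foci in the open disc, every unimodular `l` gives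
three distinct unimodular roots with `m` strictly inside their triangle, so the circle is the
incircle and not an excircle (`BlaschkeTriple.exists_barycentric`, `exists_interscribed`).

The centres in question are those with `f g = m̄ e^{it}` (`causticCenter_sq_add`). Writing `l = μ
e^{it}`, the vertices sum to `m (2 + μ)`. The circumcenter of an inscribed triangle is real-linear
in `u + v + w` and `u v w`, so `X₅ = C + (1 - Re μ) D` with a fixed vector `D`
(`eulerCenter_of_sums`). As `μ` runs over the unit circle this sweeps a segment starting at `C`; at
`μ = 1` the nine-point centre is the incenter, which forces the triangle to be equilateral.

In a non-equilateral triangle `X₁₁` lies on the ray from `X₅` through the incenter, at distance `r`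
beyond it (`PlaneTriangle.feuerbachPoint_sub`). Here the incenter is fixed and `X₅` stays on one ray
from it, so `X₁₁` is stationary, and so is `X₈₀`, twice as far out. The radius is determined by the
centre: the Cayley condition is quadratic in `r ^ 2`, and a second-moment inequality leaves one root
(`radius_unique`).

The centroid locus follows since the centroid of an equilateral triangle is its circumcenter, a
linear condition whose solution depends on `u v w` alone; conversely, each point of the locus is the
centre of the equilateral member of its family. -/

open scoped ComplexConjugate

/-! ### Heights, inradius and centres of a plane triangle in coordinates. -/

/-- Twice the signed area of the triangle `T`. -/
def PlaneTriangle.cross (T : PlaneTriangle) : ℝ :=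
  (T.points 1 0 - T.points 0 0) * (T.points 2 1 - T.points 0 1) -
    (T.points 1 1 - T.points 0 1) * (T.points 2 0 - T.points 0 0)

theorem Plane.dist_sq (p q : Plane) : dist p q ^ 2 = (p 0 - q 0) ^ 2 + (p 1 - q 1) ^ 2 := by
  rw [EuclideanSpace.dist_eq, Real.sq_sqrt (by positivity)]
  simp [Fin.sum_univ_two, Real.dist_eq, sq_abs]

theorem Plane.ext {p q : Plane} (h0 : p 0 = q 0) (h1 : p 1 = q 1) : p = q := by
  ext i; fin_cases i <;> assumption

theorem height_mul_dist_sq (T : PlaneTriangle) {i j k : Fin 3} (hij : i ≠ j) (hik : i ≠ k) :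
    (T.height i * dist (T.points j) (T.points k)) ^ 2 =
      ((T.points i 0 - T.points j 0) * (T.points j 1 - T.points k 1) -
        (T.points i 1 - T.points j 1) * (T.points j 0 - T.points k 0)) ^ 2 := by
  have h1 := T.inner_vsub_vsub_altitudeFoot_eq_height_sq hij
  have h2 := T.inner_vsub_vsub_altitudeFoot_eq_height_sq hik
  have h3 : T.height i ^ 2 = _ := Plane.dist_sq (T.points i) (T.altitudeFoot i)
  have hpos := T.height_pos i
  rw [mul_pow, Plane.dist_sq]
  simp only [PiLp.inner_apply, Fin.sum_univ_two, vsub_eq_sub, PiLp.sub_apply] at h1 h2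
  simp at h1 h2
  generalize T.height i = h at *
  generalize T.points i 0 - T.altitudeFoot i 0 = n0 at *
  generalize T.points i 1 - T.altitudeFoot i 1 = n1 at *
  generalize T.points i 0 = a0 at *
  generalize T.points i 1 = a1 at *
  generalize T.points j 0 = b0 at *
  generalize T.points j 1 = b1 at *
  generalize T.points k 0 = c0 at *
  generalize T.points k 1 = c1 at *
  have hh : h ^ 2 ≠ 0 := by positivity
  -- The vector `n` from the foot of the altitude to the vertex is orthogonal to the base. The cross
  -- product of a side with the base is therefore that of `n` with the base, and Lagrange's identity
  -- finishes.
  have hd : (b0 - c0) * n0 + (b1 - c1) * n1 = 0 := by linear_combination h2 - h1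
  have hc : (a0 - b0) * (b1 - c1) - (a1 - b1) * (b0 - c0) =
      n0 * (b1 - c1) - n1 * (b0 - c0) := by
    apply mul_left_cancel₀ hh
    linear_combination ((a0 - b0) * (b1 - c1) - (a1 - b1) * (b0 - c0)) * h3 +
      (n0 * (b1 - c1) - n1 * (b0 - c0)) * h1 - (n0 * (a1 - b1) - n1 * (a0 - b0)) * hd
  rw [hc]
  linear_combination ((b0 - c0) ^ 2 + (b1 - c1) ^ 2) * h3 +
    ((b0 - c0) * n0 + (b1 - c1) * n1) * hd

theorem PlaneTriangle.height_zero_mul (T : PlaneTriangle) :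
    T.height 0 * dist (T.points 1) (T.points 2) = |T.cross| := by
  rw [← abs_of_nonneg (a := T.height 0 * _) (mul_nonneg (T.height_pos 0).le dist_nonneg),
    ← sq_eq_sq_iff_abs_eq_abs, height_mul_dist_sq T (by decide) (by decide), cross]
  ring

theorem PlaneTriangle.height_one_mul (T : PlaneTriangle) :
    T.height 1 * dist (T.points 2) (T.points 0) = |T.cross| := by
  rw [← abs_of_nonneg (a := T.height 1 * _) (mul_nonneg (T.height_pos 1).le dist_nonneg),
    ← sq_eq_sq_iff_abs_eq_abs, height_mul_dist_sq T (by decide) (by decide), cross]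
  ring

theorem PlaneTriangle.height_two_mul (T : PlaneTriangle) :
    T.height 2 * dist (T.points 0) (T.points 1) = |T.cross| := by
  rw [← abs_of_nonneg (a := T.height 2 * _) (mul_nonneg (T.height_pos 2).le dist_nonneg),
    ← sq_eq_sq_iff_abs_eq_abs, height_mul_dist_sq T (by decide) (by decide), cross]
  ring

theorem PlaneTriangle.dist_pos (T : PlaneTriangle) {i j : Fin 3} (h : i ≠ j) :
    0 < dist (T.points i) (T.points j) :=
  _root_.dist_pos.2 (T.independent.injective.ne h)

theorem PlaneTriangle.abs_cross_pos (T : PlaneTriangle) : 0 < |T.cross| := by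
  rw [← T.height_zero_mul]
  exact mul_pos (T.height_pos 0) (T.dist_pos (by decide))

theorem PlaneTriangle.inv_height_zero (T : PlaneTriangle) :
    (T.height 0)⁻¹ = dist (T.points 1) (T.points 2) / |T.cross| := by
  rw [← T.height_zero_mul]
  field [(T.height_pos 0).ne', (T.dist_pos (i := 1) (j := 2) (by decide)).ne']

theorem PlaneTriangle.inv_height_one (T : PlaneTriangle) :
    (T.height 1)⁻¹ = dist (T.points 2) (T.points 0) / |T.cross| := by
  rw [← T.height_one_mul]
  field [(T.height_pos 1).ne', (T.dist_pos (i := 2) (j := 0) (by decide)).ne']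

theorem PlaneTriangle.inv_height_two (T : PlaneTriangle) :
    (T.height 2)⁻¹ = dist (T.points 0) (T.points 1) / |T.cross| := by
  rw [← T.height_two_mul]
  field [(T.height_pos 2).ne', (T.dist_pos (i := 0) (j := 1) (by decide)).ne']

theorem PlaneTriangle.sum_inv_height (T : PlaneTriangle) :
    ∑ i, T.excenterWeightsUnnorm ∅ i = (dist (T.points 1) (T.points 2) +
      dist (T.points 2) (T.points 0) + dist (T.points 0) (T.points 1)) / |T.cross| := by
  refine (Fin.sum_univ_three _).trans ?_
  simp only [Affine.Simplex.excenterWeightsUnnorm_empty_apply, T.inv_height_zero, T.inv_height_one,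
    T.inv_height_two]
  ring

theorem PlaneTriangle.inradius_mul (T : PlaneTriangle) :
    T.inradius * (dist (T.points 1) (T.points 2) + dist (T.points 2) (T.points 0) +
      dist (T.points 0) (T.points 1)) = |T.cross| := by
  have hX := T.abs_cross_pos
  have h0 := T.dist_pos (i := 1) (j := 2) (by decide)
  have h1 := T.dist_pos (i := 2) (j := 0) (by decide)
  have h2 := T.dist_pos (i := 0) (j := 1) (by decide)
  rw [T.inradius_eq_abs_inv_sum, T.sum_inv_height, abs_of_pos (by positivity)]
  field

theorem PlaneTriangle.mul_incenter (T : PlaneTriangle) (k : Fin 2) :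
    (dist (T.points 1) (T.points 2) + dist (T.points 2) (T.points 0) +
      dist (T.points 0) (T.points 1)) * T.incenter k =
    dist (T.points 1) (T.points 2) * T.points 0 k + dist (T.points 2) (T.points 0) * T.points 1 k +
      dist (T.points 0) (T.points 1) * T.points 2 k := by
  have hX := T.abs_cross_pos
  have h0 := T.dist_pos (i := 1) (j := 2) (by decide)
  have h1 := T.dist_pos (i := 2) (j := 0) (by decide)
  have h2 := T.dist_pos (i := 0) (j := 1) (by decide)
  have hw := T.excenterExists_empty.sum_excenterWeights_eq_one
  have hs : ∑ i, T.excenterWeights ∅ i • T.points i = T.excenterWeights ∅ 0 • T.points 0 +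
      T.excenterWeights ∅ 1 • T.points 1 + T.excenterWeights ∅ 2 • T.points 2 :=
    Fin.sum_univ_three _
  rw [T.incenter_eq_affineCombination, Finset.affineCombination_eq_linear_combination _ _ _ hw, hs]
  simp only [Affine.Simplex.excenterWeights, Pi.smul_apply, smul_eq_mul]
  rw [T.sum_inv_height]
  simp only [smul_eq_mul, Affine.Simplex.excenterWeightsUnnorm_empty_apply, T.inv_height_zero, T.inv_height_one,
    T.inv_height_two, PiLp.add_apply, PiLp.smul_apply]
  field

theorem PlaneTriangle.eq_circumcenter (T : PlaneTriangle) {p : Plane} {r : ℝ}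
    (h0 : dist (T.points 0) p = r) (h1 : dist (T.points 1) p = r) (h2 : dist (T.points 2) p = r) :
    p = T.circumcenter := by
  refine T.eq_circumcenter_of_dist_eq ?_ (r := r) (fun i => ?_)
  · rw [T.span_eq_top (by simp)]
    trivial
  · fin_cases i <;> assumption

theorem PlaneTriangle.three_mul_centroid (T : PlaneTriangle) (k : Fin 2) :
    3 * T.centroid k = T.points 0 k + T.points 1 k + T.points 2 k := by
  have hs : ∑ i, T.points i = T.points 0 + T.points 1 + T.points 2 := Fin.sum_univ_three _
  have h : T.centroid = (3 : ℝ)⁻¹ • (T.points 0 + T.points 1 + T.points 2) := by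
    rw [← hs, Affine.Simplex.centroid, Finset.centroid_def,
      Finset.affineCombination_eq_linear_combination]
    · simp [Finset.centroidWeights_apply, Finset.smul_sum]
    · simp
  rw [h]
  simp only [PiLp.add_apply, PiLp.smul_apply, smul_eq_mul]
  ring

theorem PlaneTriangle.two_mul_eulerCenter (T : PlaneTriangle) (k : Fin 2) :
    2 * eulerCenter T k = T.points 0 k + T.points 1 k + T.points 2 k - T.circumcenter k := by
  rw [← T.three_mul_centroid, eulerCenter, Affine.Simplex.ninePointCircle_center]
  simp only [vsub_eq_sub, vadd_eq_add, PiLp.add_apply, PiLp.smul_apply, PiLp.sub_apply, smul_eq_mul]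
  push_cast
  ring

theorem affineIndependent_of_cross_ne_zero {p₀ p₁ p₂ : Plane}
    (h : (p₁ 0 - p₀ 0) * (p₂ 1 - p₀ 1) - (p₁ 1 - p₀ 1) * (p₂ 0 - p₀ 0) ≠ 0) :
    AffineIndependent ℝ ![p₀, p₁, p₂] := by
  rw [affineIndependent_iff_of_fintype]
  intro w hw hs
  rw [Finset.weightedVSub_eq_linear_combination _ hw] at hs
  replace hs := (Fin.sum_univ_three _).symm.trans hs
  replace hw := (Fin.sum_univ_three _).symm.trans hw
  have e0 := congrArg (fun q : Plane => q 0) hs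
  have e1 := congrArg (fun q : Plane => q 1) hs
  simp only [PiLp.add_apply, PiLp.smul_apply, smul_eq_mul, PiLp.zero_apply, Matrix.cons_val] at e0 e1
  have w1 : w 1 = 0 := by
    apply (mul_eq_zero.1 _).resolve_right h
    linear_combination (p₂ 1 - p₀ 1) * (e0 - p₀ 0 * hw) - (p₂ 0 - p₀ 0) * (e1 - p₀ 1 * hw)
  have w2 : w 2 = 0 := by
    apply (mul_eq_zero.1 _).resolve_right h
    linear_combination (p₁ 0 - p₀ 0) * (e1 - p₀ 1 * hw) - (p₁ 1 - p₀ 1) * (e0 - p₀ 0 * hw)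
  intro i
  fin_cases i
  · simpa [w1, w2] using hw
  · exact w1
  · exact w2

theorem PlaneTriangle.exists_points_eq {p₀ p₁ p₂ : Plane}
    (h : (p₁ 0 - p₀ 0) * (p₂ 1 - p₀ 1) - (p₁ 1 - p₀ 1) * (p₂ 0 - p₀ 0) ≠ 0) :
    ∃ T : PlaneTriangle, T.points 0 = p₀ ∧ T.points 1 = p₁ ∧ T.points 2 = p₂ :=
  ⟨⟨![p₀, p₁, p₂], affineIndependent_of_cross_ne_zero h⟩, rfl, rfl, rfl⟩

theorem PlaneTriangle.equilateral_iff (T : PlaneTriangle) :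
    T.Equilateral ↔ dist (T.points 1) (T.points 2) = dist (T.points 2) (T.points 0) ∧
      dist (T.points 2) (T.points 0) = dist (T.points 0) (T.points 1) := by
  rw [Affine.Triangle.equilateral_iff_dist_01_eq_02_and_dist_01_eq_12,
    dist_comm (T.points 2) (T.points 0)]
  constructor
  · rintro ⟨h1, h2⟩
    exact ⟨h2.symm.trans h1, h1.symm⟩
  · rintro ⟨h1, h2⟩
    exact ⟨h2.symm, h2.symm.trans h1.symm⟩

/-- A point with positive barycentric coordinates `β` at distance `r` from each of the sides is the
incenter, and `r` is the inradius. -/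
theorem PlaneTriangle.incenter_eq (T : PlaneTriangle) {C : Plane} {r β₀ β₁ β₂ : ℝ}
    (hs : β₀ + β₁ + β₂ = 1)
    (hC : ∀ k, C k = β₀ * T.points 0 k + β₁ * T.points 1 k + β₂ * T.points 2 k)
    (h0 : β₀ * |T.cross| = r * dist (T.points 1) (T.points 2))
    (h1 : β₁ * |T.cross| = r * dist (T.points 2) (T.points 0))
    (h2 : β₂ * |T.cross| = r * dist (T.points 0) (T.points 1)) :
    T.incenter = C ∧ T.inradius = r := by
  have hX := T.abs_cross_pos
  have p0 := T.dist_pos (i := 1) (j := 2) (by decide)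
  have p1 := T.dist_pos (i := 2) (j := 0) (by decide)
  have p2 := T.dist_pos (i := 0) (j := 1) (by decide)
  have hr := T.inradius_mul
  have hr' : T.inradius = r := by
    have : 0 < dist (T.points 1) (T.points 2) + dist (T.points 2) (T.points 0) +
      dist (T.points 0) (T.points 1) := by positivity
    apply mul_right_cancel₀ this.ne'
    linear_combination hr - hs * |T.cross| + h0 + h1 + h2
  refine ⟨?_, hr'⟩
  have key : ∀ k, T.incenter k = C k := by
    intro k
    have hm := T.mul_incenter k
    apply mul_left_cancel₀ hX.ne'
    rw [hr'] at hr
    rw [hC]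
    linear_combination r * hm - T.incenter k * hr - T.points 0 k * h0 - T.points 1 k * h1 -
      T.points 2 k * h2
  exact Plane.ext (key 0) (key 1)

/-! ### The triangle seen from its incenter, in tangent lengths. -/

/-- Distance from a vertex to the incenter (placed at the origin), in terms of the tangent
lengths `x`, `y`, `z`. -/
theorem vertex_sq_of_tangent_lengths {p₁ q₁ p₂ q₂ p₃ q₃ x y z : ℝ}
    (hs : 0 < x + y + z)
    (hp : (y + z) * p₁ + (z + x) * p₂ + (x + y) * p₃ = 0)
    (hq : (y + z) * q₁ + (z + x) * q₂ + (x + y) * q₃ = 0)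
    (d₁ : (p₂ - p₃) ^ 2 + (q₂ - q₃) ^ 2 = (y + z) ^ 2)
    (d₂ : (p₃ - p₁) ^ 2 + (q₃ - q₁) ^ 2 = (z + x) ^ 2)
    (d₃ : (p₁ - p₂) ^ 2 + (q₁ - q₂) ^ 2 = (x + y) ^ 2) :
    (x + y + z) * (p₁ ^ 2 + q₁ ^ 2) = x * (x + y) * (x + z) := by
  -- Pairing the relation `hp`, `hq` with each vertex and removing mixed products by the law of
  -- cosines leaves a linear system in the three squared distances.
  have e₁ : (y + z) * (p₁ ^ 2 + q₁ ^ 2) +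
      (z + x) * ((p₁ ^ 2 + q₁ ^ 2 + (p₂ ^ 2 + q₂ ^ 2) - (x + y) ^ 2) / 2) +
      (x + y) * ((p₁ ^ 2 + q₁ ^ 2 + (p₃ ^ 2 + q₃ ^ 2) - (z + x) ^ 2) / 2) = 0 := by
    linear_combination p₁ * hp + q₁ * hq + (z + x) / 2 * d₃ + (x + y) / 2 * d₂
  have e₂ : (z + x) * (p₂ ^ 2 + q₂ ^ 2) +
      (x + y) * ((p₂ ^ 2 + q₂ ^ 2 + (p₃ ^ 2 + q₃ ^ 2) - (y + z) ^ 2) / 2) +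
      (y + z) * ((p₂ ^ 2 + q₂ ^ 2 + (p₁ ^ 2 + q₁ ^ 2) - (x + y) ^ 2) / 2) = 0 := by
    linear_combination p₂ * hp + q₂ * hq + (x + y) / 2 * d₁ + (y + z) / 2 * d₃
  have e₃ : (x + y) * (p₃ ^ 2 + q₃ ^ 2) +
      (y + z) * ((p₃ ^ 2 + q₃ ^ 2 + (p₁ ^ 2 + q₁ ^ 2) - (z + x) ^ 2) / 2) +
      (z + x) * ((p₃ ^ 2 + q₃ ^ 2 + (p₂ ^ 2 + q₂ ^ 2) - (y + z) ^ 2) / 2) = 0 := by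
    linear_combination p₃ * hp + q₃ * hq + (y + z) / 2 * d₂ + (z + x) / 2 * d₁
  apply mul_left_cancel₀ hs.ne'
  linear_combination (x + y + z) * e₁ - (y + z) / 4 * e₁ - (z + x) / 4 * e₂ - (x + y) / 4 * e₃

/-- The distances and inner products of the vertices of a triangle, seen from its incenter, in
terms of the tangent lengths and the inradius. -/
structure IncenterGram (p₁ q₁ p₂ q₂ p₃ q₃ x y z r : ℝ) : Prop where
  posx : 0 < x
  posy : 0 < y
  posz : 0 < z
  posr : 0 < r
  bary_p : (y + z) * p₁ + (z + x) * p₂ + (x + y) * p₃ = 0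
  bary_q : (y + z) * q₁ + (z + x) * q₂ + (x + y) * q₃ = 0
  r_sq : r ^ 2 * (x + y + z) = x * y * z
  g11 : p₁ * p₁ + q₁ * q₁ = x ^ 2 + r ^ 2
  g22 : p₂ * p₂ + q₂ * q₂ = y ^ 2 + r ^ 2
  g33 : p₃ * p₃ + q₃ * q₃ = z ^ 2 + r ^ 2
  g12 : p₁ * p₂ + q₁ * q₂ = r ^ 2 - x * y
  g23 : p₂ * p₃ + q₂ * q₃ = r ^ 2 - y * z
  g31 : p₃ * p₁ + q₃ * q₁ = r ^ 2 - z * x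

theorem IncenterGram.of_dist {p₁ q₁ p₂ q₂ p₃ q₃ x y z r : ℝ}
    (hx : 0 < x) (hy : 0 < y) (hz : 0 < z) (hr : 0 < r)
    (hp : (y + z) * p₁ + (z + x) * p₂ + (x + y) * p₃ = 0)
    (hq : (y + z) * q₁ + (z + x) * q₂ + (x + y) * q₃ = 0)
    (d₁ : (p₂ - p₃) ^ 2 + (q₂ - q₃) ^ 2 = (y + z) ^ 2)
    (d₂ : (p₃ - p₁) ^ 2 + (q₃ - q₁) ^ 2 = (z + x) ^ 2)
    (d₃ : (p₁ - p₂) ^ 2 + (q₁ - q₂) ^ 2 = (x + y) ^ 2)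
    (hX : r * (2 * (x + y + z)) = |(p₂ - p₁) * (q₃ - q₁) - (q₂ - q₁) * (p₃ - p₁)|) :
    IncenterGram p₁ q₁ p₂ q₂ p₃ q₃ x y z r := by
  have hs : 0 < x + y + z := by positivity
  -- Heron's formula: the squared cross product is the Gram determinant of two sides.
  have hR : r ^ 2 * (x + y + z) = x * y * z := by
    have h2 := congrArg (· ^ 2) hX
    simp only [sq_abs] at h2
    have h3 : (p₂ - p₁) * (p₃ - p₁) + (q₂ - q₁) * (q₃ - q₁) =
        ((x + y) ^ 2 + (z + x) ^ 2 - (y + z) ^ 2) / 2 := by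
      linear_combination (d₃ + d₂ - d₁) / 2
    apply mul_left_cancel₀ (mul_pos four_pos hs).ne'
    linear_combination h2 + ((p₁ - p₂) ^ 2 + (q₁ - q₂) ^ 2) * d₂ + (z + x) ^ 2 * d₃ -
      ((p₂ - p₁) * (p₃ - p₁) + (q₂ - q₁) * (q₃ - q₁) +
        ((x + y) ^ 2 + (z + x) ^ 2 - (y + z) ^ 2) / 2) * h3
  have a₁ := vertex_sq_of_tangent_lengths hs hp hq d₁ d₂ d₃
  have a₂ := vertex_sq_of_tangent_lengths (x := y) (y := z) (z := x) (by linarith)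
    (by linear_combination hp) (by linear_combination hq) d₂ d₃ d₁
  have a₃ := vertex_sq_of_tangent_lengths (x := z) (y := x) (z := y) (by linarith)
    (by linear_combination hp) (by linear_combination hq) d₃ d₁ d₂
  have g₁ : p₁ * p₁ + q₁ * q₁ = x ^ 2 + r ^ 2 := by
    apply mul_left_cancel₀ hs.ne'
    linear_combination a₁ - hR
  have g₂ : p₂ * p₂ + q₂ * q₂ = y ^ 2 + r ^ 2 := by
    apply mul_left_cancel₀ hs.ne'
    linear_combination a₂ - hR
  have g₃ : p₃ * p₃ + q₃ * q₃ = z ^ 2 + r ^ 2 := by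
    apply mul_left_cancel₀ hs.ne'
    linear_combination a₃ - hR
  exact ⟨hx, hy, hz, hr, hp, hq, hR, g₁, g₂, g₃, by linear_combination (g₁ + g₂ - d₃) / 2,
    by linear_combination (g₂ + g₃ - d₁) / 2, by linear_combination (g₃ + g₁ - d₂) / 2⟩

namespace IncenterGram

variable {p₁ q₁ p₂ q₂ p₃ q₃ x y z r : ℝ}

/-- The Feuerbach point is at distance `r` from the incenter. -/
theorem feuerbach_norm (h : IncenterGram p₁ q₁ p₂ q₂ p₃ q₃ x y z r) :
    (x * (y - z) ^ 2 * p₁ + y * (z - x) ^ 2 * p₂ + z * (x - y) ^ 2 * p₃) ^ 2 +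
      (x * (y - z) ^ 2 * q₁ + y * (z - x) ^ 2 * q₂ + z * (x - y) ^ 2 * q₃) ^ 2 =
    r ^ 2 * (x * (y - z) ^ 2 + y * (z - x) ^ 2 + z * (x - y) ^ 2) ^ 2 := by
  -- The terms without `r` cancel: with `A = x (y - z)`, `B = y (z - x)`, `C = z (x - y)` they are
  -- `A⁴ + B⁴ + C⁴ - 2 (A²B² + B²C² + C²A²)`, which is divisible by `A + B + C = 0`.
  linear_combination (x * (y - z) ^ 2) ^ 2 * h.g11 + (y * (z - x) ^ 2) ^ 2 * h.g22 +
    (z * (x - y) ^ 2) ^ 2 * h.g33 + 2 * (x * (y - z) ^ 2) * (y * (z - x) ^ 2) * h.g12 +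
    2 * (y * (z - x) ^ 2) * (z * (x - y) ^ 2) * h.g23 +
    2 * (z * (x - y) ^ 2) * (x * (y - z) ^ 2) * h.g31

/-- Lagrange's identity applied to the Gram entries. Geometrically, a side of length `x + y` is at
distance `r` from the incenter. -/
theorem cross_sq (h : IncenterGram p₁ q₁ p₂ q₂ p₃ q₃ x y z r) :
    (p₁ * q₂ - q₁ * p₂) ^ 2 = r ^ 2 * (x + y) ^ 2 := by
  linear_combination (p₂ * p₂ + q₂ * q₂) * h.g11 + (x ^ 2 + r ^ 2) * h.g22 -
    (p₁ * p₂ + q₁ * q₂ + r ^ 2 - x * y) * h.g12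

theorem rotate (h : IncenterGram p₁ q₁ p₂ q₂ p₃ q₃ x y z r) :
    IncenterGram p₂ q₂ p₃ q₃ p₁ q₁ y z x r := by
  obtain ⟨hx, hy, hz, hr, hp, hq, hR, g₁, g₂, g₃, g₁₂, g₂₃, g₃₁⟩ := h
  exact ⟨hy, hz, hx, hr, by linarith, by linarith, by linarith, g₂, g₃, g₁, g₂₃, g₃₁, g₁₂⟩

theorem cross_ne_zero (h : IncenterGram p₁ q₁ p₂ q₂ p₃ q₃ x y z r) :
    p₁ * q₂ - q₁ * p₂ ≠ 0 := by
  have := h.posx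
  have := h.posy
  have := h.posr
  intro h0
  have h1 := h.cross_sq
  rw [h0] at h1
  have : 0 < r ^ 2 * (x + y) ^ 2 := by positivity
  linarith

/-- Twice the nine-point centre relative to the incenter, which is the sum of the vertices minus
the circumcenter `(o, w)`, in terms of the Feuerbach weights. -/
theorem euler_center (h : IncenterGram p₁ q₁ p₂ q₂ p₃ q₃ x y z r) {o w : ℝ}
    (e₁ : (p₁ - o) ^ 2 + (q₁ - w) ^ 2 = (p₂ - o) ^ 2 + (q₂ - w) ^ 2)
    (e₂ : (p₂ - o) ^ 2 + (q₂ - w) ^ 2 = (p₃ - o) ^ 2 + (q₃ - w) ^ 2) :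
    4 * (x * y * z) * (p₁ + p₂ + p₃ - o) =
        -(x * (y - z) ^ 2 * p₁ + y * (z - x) ^ 2 * p₂ + z * (x - y) ^ 2 * p₃) ∧
      4 * (x * y * z) * (q₁ + q₂ + q₃ - w) =
        -(x * (y - z) ^ 2 * q₁ + y * (z - x) ^ 2 * q₂ + z * (x - y) ^ 2 * q₃) := by
  have hs : 0 < x + y + z := by have := h.posx; have := h.posy; have := h.posz; positivity
  obtain ⟨hx, hy, hz, hr, hp, hq, hR, g₁, g₂, g₃, g₁₂, g₂₃, g₃₁⟩ := id h
  -- Equidistance from `(o, w)` makes `⟨pᵢ, o⟩ - |pᵢ|² / 2` the same for all vertices; weighting by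
  -- the sides gives its value in `k₁`.
  have f₂ : p₂ * o + q₂ * w - (y ^ 2 + r ^ 2) / 2 = p₁ * o + q₁ * w - (x ^ 2 + r ^ 2) / 2 := by
    linear_combination e₁ / 2 - g₁ / 2 + g₂ / 2
  have f₃ : p₃ * o + q₃ * w - (z ^ 2 + r ^ 2) / 2 = p₁ * o + q₁ * w - (x ^ 2 + r ^ 2) / 2 := by
    linear_combination e₂ / 2 + e₁ / 2 - g₁ / 2 + g₃ / 2
  have k₁ : (x + y + z) * (p₁ * o + q₁ * w - (x ^ 2 + r ^ 2) / 2) * 4 =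
      -((y + z) * (z + x) * (x + y)) := by
    linear_combination 2 * o * hp + 2 * w * hq - 2 * (z + x) * f₂ - 2 * (x + y) * f₃ - 2 * hR
  -- The vector that should vanish is orthogonal to the first two vertices, which are linearly
  -- independent.
  have u₁ : (4 * (x * y * z) * (p₁ + p₂ + p₃ - o) +
        (x * (y - z) ^ 2 * p₁ + y * (z - x) ^ 2 * p₂ + z * (x - y) ^ 2 * p₃)) * p₁ +
      (4 * (x * y * z) * (q₁ + q₂ + q₃ - w) +
        (x * (y - z) ^ 2 * q₁ + y * (z - x) ^ 2 * q₂ + z * (x - y) ^ 2 * q₃)) * q₁ = 0 := by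
    apply mul_left_cancel₀ hs.ne'
    linear_combination (x + y + z) * ((4 * (x * y * z) + x * (y - z) ^ 2) * g₁ +
      (4 * (x * y * z) + y * (z - x) ^ 2) * g₁₂ + (4 * (x * y * z) + z * (x - y) ^ 2) * g₃₁) -
      x * y * z * k₁ +
      (10 * (x * y * z) + x * (y - z) ^ 2 + y * (z - x) ^ 2 + z * (x - y) ^ 2) * hR
  have u₂ : (4 * (x * y * z) * (p₁ + p₂ + p₃ - o) +
        (x * (y - z) ^ 2 * p₁ + y * (z - x) ^ 2 * p₂ + z * (x - y) ^ 2 * p₃)) * p₂ +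
      (4 * (x * y * z) * (q₁ + q₂ + q₃ - w) +
        (x * (y - z) ^ 2 * q₁ + y * (z - x) ^ 2 * q₂ + z * (x - y) ^ 2 * q₃)) * q₂ = 0 := by
    apply mul_left_cancel₀ hs.ne'
    linear_combination (x + y + z) * ((4 * (x * y * z) + x * (y - z) ^ 2) * g₁₂ +
      (4 * (x * y * z) + y * (z - x) ^ 2) * g₂ + (4 * (x * y * z) + z * (x - y) ^ 2) * g₂₃) -
      x * y * z * k₁ - 4 * (x * y * z) * (x + y + z) * f₂ +
      (10 * (x * y * z) + x * (y - z) ^ 2 + y * (z - x) ^ 2 + z * (x - y) ^ 2) * hR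
  have hc := h.cross_ne_zero
  constructor
  · apply mul_left_cancel₀ hc
    linear_combination q₂ * u₁ - q₁ * u₂
  · apply mul_left_cancel₀ hc
    linear_combination p₁ * u₂ - p₂ * u₁

theorem swap (h : IncenterGram p₁ q₁ p₂ q₂ p₃ q₃ x y z r) :
    IncenterGram q₁ p₁ q₂ p₂ q₃ p₃ x y z r := by
  obtain ⟨hx, hy, hz, hr, hp, hq, hR, g₁, g₂, g₃, g₁₂, g₂₃, g₃₁⟩ := h
  exact ⟨hx, hy, hz, hr, hq, hp, hR, by linarith, by linarith, by linarith, by linarith,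
    by linarith, by linarith⟩

/-- The second moment of the vertices, with masses the opposite sides, about any line through the
incenter exceeds `r ^ 2` times the perimeter. -/
theorem moment_gt (h : IncenterGram p₁ q₁ p₂ q₂ p₃ q₃ x y z r) :
    r ^ 2 * (2 * (x + y + z)) < (y + z) * p₁ ^ 2 + (z + x) * p₂ ^ 2 + (x + y) * p₃ ^ 2 := by
  obtain ⟨hx, hy, hz, hr, hp, hq, hR, g₁, g₂, g₃, g₁₂, g₂₃, g₃₁⟩ := id h
  have c₁₂ := h.cross_sq
  have c₂₃ := h.rotate.cross_sq
  have c₃₁ := h.rotate.rotate.cross_sq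
  -- `M`, `N`, `K` are the entries of the second-moment matrix. Its determinant is `r ^ 2 * S` times
  -- its trace, so subtracting `r ^ 2 * S` from the diagonal leaves determinant `(r ^ 2 * S) ^ 2`;
  -- the trace also stays positive, so the shifted matrix is positive definite.
  set M := (y + z) * p₁ ^ 2 + (z + x) * p₂ ^ 2 + (x + y) * p₃ ^ 2 with hM
  set N := (y + z) * q₁ ^ 2 + (z + x) * q₂ ^ 2 + (x + y) * q₃ ^ 2 with hN
  set K := (y + z) * p₁ * q₁ + (z + x) * p₂ * q₂ + (x + y) * p₃ * q₃ with hK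
  set S := 2 * (x + y + z) with hS
  have hSpos : 0 < S := by positivity
  have htr : M + N = (x + y) * (y + z) * (z + x) := by
    rw [hM, hN]
    linear_combination (y + z) * g₁ + (z + x) * g₂ + (x + y) * g₃ + 2 * hR
  have hdet : M * N - K ^ 2 = r ^ 2 * ((x + y) * (y + z) * (z + x)) * S := by
    rw [hM, hN, hK, hS]
    linear_combination (y + z) * (z + x) * c₁₂ + (z + x) * (x + y) * c₂₃ + (x + y) * (y + z) * c₃₁
  have hprod : (M - r ^ 2 * S) * (N - r ^ 2 * S) = r ^ 4 * S ^ 2 + K ^ 2 := by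
    linear_combination hdet - r ^ 2 * S * htr
  have hsum : 0 < (M - r ^ 2 * S) + (N - r ^ 2 * S) := by
    have : (M - r ^ 2 * S) + (N - r ^ 2 * S) =
        x * (y - z) ^ 2 + y * (z - x) ^ 2 + z * (x - y) ^ 2 + 4 * (x * y * z) := by
      rw [hS]
      linear_combination htr - 4 * hR
    rw [this]
    positivity
  have hpos : 0 < (M - r ^ 2 * S) * (N - r ^ 2 * S) := by
    rw [hprod]
    positivity
  rcases mul_pos_iff.1 hpos with h1 | h1
  · linarith [h1.1]
  · linarith [h1.1, h1.2]

end IncenterGram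

theorem PlaneTriangle.incenterGram (T : PlaneTriangle) :
    IncenterGram (T.points 0 0 - T.incenter 0) (T.points 0 1 - T.incenter 1)
      (T.points 1 0 - T.incenter 0) (T.points 1 1 - T.incenter 1)
      (T.points 2 0 - T.incenter 0) (T.points 2 1 - T.incenter 1)
      ((dist (T.points 2) (T.points 0) + dist (T.points 0) (T.points 1) -
        dist (T.points 1) (T.points 2)) / 2)
      ((dist (T.points 0) (T.points 1) + dist (T.points 1) (T.points 2) -
        dist (T.points 2) (T.points 0)) / 2)
      ((dist (T.points 1) (T.points 2) + dist (T.points 2) (T.points 0) -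
        dist (T.points 0) (T.points 1)) / 2) T.inradius := by
  have hX := T.abs_cross_pos
  have d₁ := Plane.dist_sq (T.points 1) (T.points 2)
  have d₂ := Plane.dist_sq (T.points 2) (T.points 0)
  have d₃ := Plane.dist_sq (T.points 0) (T.points 1)
  have h0 := T.dist_pos (i := 1) (j := 2) (by decide)
  have h1 := T.dist_pos (i := 2) (j := 0) (by decide)
  have h2 := T.dist_pos (i := 0) (j := 1) (by decide)
  have hm0 := T.mul_incenter 0
  have hm1 := T.mul_incenter 1
  have hr := T.inradius_mul
  have hX2 : 0 < T.cross ^ 2 := by rw [← sq_abs]; positivity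
  -- Since the area is nonzero, Heron's formula makes the triangle inequalities strict, hence the
  -- tangent lengths positive.
  have heron : 4 * T.cross ^ 2 =
      (dist (T.points 1) (T.points 2) + dist (T.points 2) (T.points 0) +
        dist (T.points 0) (T.points 1)) *
      ((dist (T.points 2) (T.points 0) + dist (T.points 0) (T.points 1) -
        dist (T.points 1) (T.points 2)) *
      (dist (T.points 0) (T.points 1) + dist (T.points 1) (T.points 2) -
        dist (T.points 2) (T.points 0)) *
      (dist (T.points 1) (T.points 2) + dist (T.points 2) (T.points 0) -
        dist (T.points 0) (T.points 1))) := by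
    have e : ∀ l₁ l₂ l₃ : ℝ, (l₁ + l₂ + l₃) * ((l₂ + l₃ - l₁) * (l₃ + l₁ - l₂) * (l₁ + l₂ - l₃)) =
      4 * l₂ ^ 2 * l₃ ^ 2 - (l₂ ^ 2 + l₃ ^ 2 - l₁ ^ 2) ^ 2 := by intros; ring
    rw [e, d₁, d₂, d₃, cross]
    ring
  have t₁ := dist_triangle (T.points 1) (T.points 0) (T.points 2)
  have t₂ := dist_triangle (T.points 2) (T.points 1) (T.points 0)
  have t₃ := dist_triangle (T.points 0) (T.points 2) (T.points 1)
  rw [dist_comm (T.points 1) (T.points 0), dist_comm (T.points 0) (T.points 2)] at t₁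
  rw [dist_comm (T.points 2) (T.points 1), dist_comm (T.points 1) (T.points 0)] at t₂
  rw [dist_comm (T.points 0) (T.points 2), dist_comm (T.points 2) (T.points 1)] at t₃
  have hrr := T.inradius_pos
  rw [cross] at hr heron hX2
  generalize dist (T.points 1) (T.points 2) = l₁ at *
  generalize dist (T.points 2) (T.points 0) = l₂ at *
  generalize dist (T.points 0) (T.points 1) = l₃ at *
  have hne : l₂ + l₃ - l₁ ≠ 0 ∧ l₃ + l₁ - l₂ ≠ 0 ∧ l₁ + l₂ - l₃ ≠ 0 := by
    refine ⟨fun h => ?_, fun h => ?_, fun h => ?_⟩ <;> rw [h] at heron <;> linarith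
  have a₁ : 0 < l₂ + l₃ - l₁ := lt_of_le_of_ne (by linarith) hne.1.symm
  have a₂ : 0 < l₃ + l₁ - l₂ := lt_of_le_of_ne (by linarith) hne.2.1.symm
  have a₃ : 0 < l₁ + l₂ - l₃ := lt_of_le_of_ne (by linarith) hne.2.2.symm
  refine IncenterGram.of_dist (by linarith) (by linarith) (by linarith) hrr
    (by linear_combination -hm0) (by linear_combination -hm1)
    (by linear_combination -d₁) (by linear_combination -d₂) (by linear_combination -d₃) ?_
  convert hr using 2 <;> ring

/-! ### The Feuerbach point and the nine-point centre. -/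

/-- The sum of the barycentric weights of the Feuerbach point, which vanishes exactly for equilateral triangles. -/
noncomputable def PlaneTriangle.feuerbachWeight (T : PlaneTriangle) : ℝ :=
  let l₁ := dist (T.points 1) (T.points 2)
  let l₂ := dist (T.points 2) (T.points 0)
  let l₃ := dist (T.points 0) (T.points 1)
  (l₂ + l₃ - l₁) * (l₂ - l₃) ^ 2 + (l₃ + l₁ - l₂) * (l₃ - l₁) ^ 2 + (l₁ + l₂ - l₃) * (l₁ - l₂) ^ 2

theorem PlaneTriangle.feuerbachWeight_nonneg (T : PlaneTriangle) : 0 ≤ T.feuerbachWeight := by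
  have h := T.incenterGram
  have hx := h.posx
  have hy := h.posy
  have hz := h.posz
  unfold feuerbachWeight
  have := mul_nonneg hx.le (sq_nonneg (dist (T.points 2) (T.points 0) - dist (T.points 0) (T.points 1)))
  have := mul_nonneg hy.le (sq_nonneg (dist (T.points 0) (T.points 1) - dist (T.points 1) (T.points 2)))
  have := mul_nonneg hz.le (sq_nonneg (dist (T.points 1) (T.points 2) - dist (T.points 2) (T.points 0)))
  simp only
  linarith

theorem PlaneTriangle.feuerbachWeight_eq_zero_iff (T : PlaneTriangle) :
    T.feuerbachWeight = 0 ↔ T.Equilateral := by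
  have h := T.incenterGram
  have hx := h.posx
  have hy := h.posy
  have hz := h.posz
  rw [T.equilateral_iff]
  unfold feuerbachWeight
  simp only
  generalize dist (T.points 1) (T.points 2) = l₁ at *
  generalize dist (T.points 2) (T.points 0) = l₂ at *
  generalize dist (T.points 0) (T.points 1) = l₃ at *
  constructor
  · intro h0
    have n₁ := mul_nonneg hx.le (sq_nonneg (l₂ - l₃))
    have n₂ := mul_nonneg hy.le (sq_nonneg (l₃ - l₁))
    have n₃ := mul_nonneg hz.le (sq_nonneg (l₁ - l₂))
    have z₁ : (l₂ + l₃ - l₁) / 2 * (l₂ - l₃) ^ 2 = 0 := by linarith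
    have z₃ : (l₁ + l₂ - l₃) / 2 * (l₁ - l₂) ^ 2 = 0 := by linarith
    constructor
    · exact sub_eq_zero.1 (pow_eq_zero_iff two_ne_zero |>.1 ((mul_eq_zero.1 z₃).resolve_left hz.ne'))
    · exact sub_eq_zero.1 (pow_eq_zero_iff two_ne_zero |>.1 ((mul_eq_zero.1 z₁).resolve_left hx.ne'))
  · rintro ⟨rfl, rfl⟩
    ring

/-- The nine-point centre, relative to the incenter, as a multiple of the Feuerbach vector. -/
theorem PlaneTriangle.mul_eulerCenter_sub (T : PlaneTriangle) : ∃ κ : ℝ, 0 < κ ∧ ∃ v : Fin 2 → ℝ,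
    (∀ k, κ * (eulerCenter T k - T.incenter k) = -v k) ∧
    v 0 ^ 2 + v 1 ^ 2 = T.inradius ^ 2 * T.feuerbachWeight ^ 2 ∧
    (T.feuerbachWeight ≠ 0 →
      ∀ k, T.feuerbachWeight * (feuerbachPoint T k - T.incenter k) = v k) := by
  have h := T.incenterGram
  have hx := h.posx
  have hy := h.posy
  have hz := h.posz
  have hO : ∀ i, (T.points i 0 - T.circumcenter 0) ^ 2 + (T.points i 1 - T.circumcenter 1) ^ 2 =
      T.circumradius ^ 2 := by
    intro i
    rw [← Plane.dist_sq, T.dist_circumcenter_eq_circumradius]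
  have hn := h.feuerbach_norm
  obtain ⟨u0, u1⟩ := h.euler_center (o := T.circumcenter 0 - T.incenter 0)
    (w := T.circumcenter 1 - T.incenter 1)
    (by linear_combination hO 0 - hO 1) (by linear_combination hO 1 - hO 2)
  have n0 := T.two_mul_eulerCenter 0
  have n1 := T.two_mul_eulerCenter 1
  have hF : T.feuerbachWeight ≠ 0 → ∀ k, T.feuerbachWeight * feuerbachPoint T k =
      (dist (T.points 2) (T.points 0) + dist (T.points 0) (T.points 1) -
        dist (T.points 1) (T.points 2)) *
        (dist (T.points 2) (T.points 0) - dist (T.points 0) (T.points 1)) ^ 2 * T.points 0 k +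
      (dist (T.points 0) (T.points 1) + dist (T.points 1) (T.points 2) -
        dist (T.points 2) (T.points 0)) *
        (dist (T.points 0) (T.points 1) - dist (T.points 1) (T.points 2)) ^ 2 * T.points 1 k +
      (dist (T.points 1) (T.points 2) + dist (T.points 2) (T.points 0) -
        dist (T.points 0) (T.points 1)) *
        (dist (T.points 1) (T.points 2) - dist (T.points 2) (T.points 0)) ^ 2 * T.points 2 k := by
    intro h0 k
    have : feuerbachPoint T k = T.feuerbachWeight⁻¹ * (
      (dist (T.points 2) (T.points 0) + dist (T.points 0) (T.points 1) -
        dist (T.points 1) (T.points 2)) *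
        (dist (T.points 2) (T.points 0) - dist (T.points 0) (T.points 1)) ^ 2 * T.points 0 k +
      (dist (T.points 0) (T.points 1) + dist (T.points 1) (T.points 2) -
        dist (T.points 2) (T.points 0)) *
        (dist (T.points 0) (T.points 1) - dist (T.points 1) (T.points 2)) ^ 2 * T.points 1 k +
      (dist (T.points 1) (T.points 2) + dist (T.points 2) (T.points 0) -
        dist (T.points 0) (T.points 1)) *
        (dist (T.points 1) (T.points 2) - dist (T.points 2) (T.points 0)) ^ 2 * T.points 2 k) := rfl
    rw [this, mul_inv_cancel_left₀ h0]
  revert hF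
  unfold feuerbachWeight
  simp only
  intro hF
  generalize dist (T.points 1) (T.points 2) = l₁ at *
  generalize dist (T.points 2) (T.points 0) = l₂ at *
  generalize dist (T.points 0) (T.points 1) = l₃ at *
  -- The `4 * (x * y * z)` of `IncenterGram.euler_center` is doubled twice: its left side is twice
  -- the nine-point offset, and the weights in sidelengths are twice those in tangent lengths.
  refine ⟨16 * ((l₂ + l₃ - l₁) / 2 * ((l₃ + l₁ - l₂) / 2) * ((l₁ + l₂ - l₃) / 2)), by positivity,
    fun k => (l₂ + l₃ - l₁) * (l₂ - l₃) ^ 2 * (T.points 0 k - T.incenter k) +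
      (l₃ + l₁ - l₂) * (l₃ - l₁) ^ 2 * (T.points 1 k - T.incenter k) +
      (l₁ + l₂ - l₃) * (l₁ - l₂) ^ 2 * (T.points 2 k - T.incenter k), ?_, ?_, ?_⟩
  · intro k
    fin_cases k
    · simp only [Fin.zero_eta, Fin.isValue]
      linear_combination 2 * u0 +
        8 * ((l₂ + l₃ - l₁) / 2 * ((l₃ + l₁ - l₂) / 2) * ((l₁ + l₂ - l₃) / 2)) * n0
    · simp only [Fin.mk_one, Fin.isValue]
      linear_combination 2 * u1 +
        8 * ((l₂ + l₃ - l₁) / 2 * ((l₃ + l₁ - l₂) / 2) * ((l₁ + l₂ - l₃) / 2)) * n1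
  · linear_combination 4 * hn
  · intro h0 k
    linear_combination hF h0 k

/-- The Feuerbach vector is then zero, but its length is the inradius times the sum of the weights.
-/
theorem PlaneTriangle.equilateral_of_eulerCenter_eq (T : PlaneTriangle)
    (h : eulerCenter T = T.incenter) : T.Equilateral := by
  obtain ⟨κ, hκ, v, hv, hn, -⟩ := T.mul_eulerCenter_sub
  rw [← T.feuerbachWeight_eq_zero_iff]
  have v0 := hv 0
  have v1 := hv 1
  rw [h, sub_self, mul_zero, zero_eq_neg] at v0 v1
  rw [v0, v1] at hn
  have hr := T.inradius_pos
  have : T.inradius ^ 2 * T.feuerbachWeight ^ 2 = 0 := by linarith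
  simpa [hr.ne'] using this

/-- The Feuerbach point of a non-equilateral triangle lies on the ray from the nine-point centre
through the incenter, beyond the incenter, at distance the inradius from it. -/
theorem PlaneTriangle.feuerbachPoint_sub (T : PlaneTriangle) (h : ¬ T.Equilateral) :
    (∃ ν : ℝ, 0 < ν ∧ ∀ k, feuerbachPoint T k - T.incenter k =
      -(ν * (eulerCenter T k - T.incenter k))) ∧
    (feuerbachPoint T 0 - T.incenter 0) ^ 2 + (feuerbachPoint T 1 - T.incenter 1) ^ 2 =
      T.inradius ^ 2 := by
  obtain ⟨κ, hκ, v, hv, hn, hF⟩ := T.mul_eulerCenter_sub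
  rw [← T.feuerbachWeight_eq_zero_iff] at h
  have hpos := lt_of_le_of_ne T.feuerbachWeight_nonneg (Ne.symm h)
  refine ⟨⟨κ / T.feuerbachWeight, by positivity, fun k => ?_⟩, ?_⟩
  · apply mul_left_cancel₀ h
    rw [hF h, ← neg_eq_iff_eq_neg.2 (hv k)]
    field
  · apply mul_left_cancel₀ (pow_ne_zero 2 h)
    rw [mul_comm (_ ^ 2) (T.inradius ^ 2), ← hn, ← hF h, ← hF h]
    ring

/-! ### Blaschke products of degree three and triangles in the unit circle. -/

/-- The complex roots of a monic cubic with a known root `u`. -/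
theorem exists_roots_of_root {s₁ s₂ s₃ u : ℂ} (hu : u ^ 3 - s₁ * u ^ 2 + s₂ * u - s₃ = 0) :
    ∃ v w : ℂ, u + v + w = s₁ ∧ u * v + v * w + w * u = s₂ ∧ u * v * w = s₃ := by
  obtain ⟨d, hd⟩ := IsAlgClosed.exists_pow_nat_eq
    ((s₁ - u) ^ 2 - 4 * (s₂ - u * (s₁ - u))) (n := 2) two_pos
  refine ⟨((s₁ - u) + d) / 2, ((s₁ - u) - d) / 2, by ring, ?_, ?_⟩
  · linear_combination -hd / 4
  · linear_combination -u * hd / 4 + hu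

theorem exists_roots (s₁ s₂ s₃ : ℂ) :
    ∃ u v w : ℂ, u + v + w = s₁ ∧ u * v + v * w + w * u = s₂ ∧ u * v * w = s₃ := by
  obtain ⟨u, hu⟩ : ∃ u : ℂ, u ^ 3 - s₁ * u ^ 2 + s₂ * u - s₃ = 0 := by
    have hdeg : (Polynomial.X ^ 3 - Polynomial.C s₁ * Polynomial.X ^ 2 +
        Polynomial.C s₂ * Polynomial.X - Polynomial.C s₃ : Polynomial ℂ).degree = 3 := by
      compute_degree!
    obtain ⟨u, hu⟩ := IsAlgClosed.exists_root _ (by rw [hdeg]; decide)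
    exact ⟨u, by simpa [Polynomial.IsRoot] using hu⟩
  exact ⟨u, exists_roots_of_root hu⟩

/-- For `|f| < 1` the sign of the right side is that of `|z| - 1`: this decides on which side of 1 a
Blaschke factor lies. -/
theorem normSq_sub_sub_normSq (z f : ℂ) :
    Complex.normSq (z - f) - Complex.normSq (1 - conj f * z) =
      -((1 - Complex.normSq z) * (1 - Complex.normSq f)) := by
  simp only [Complex.normSq_apply, Complex.sub_re, Complex.sub_im, Complex.mul_re, Complex.mul_im,
    Complex.conj_re, Complex.conj_im, Complex.one_re, Complex.one_im]
  ring

/-- A finite Blaschke product of degree three takes unimodular values only on the unit circle. -/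
theorem normSq_eq_one_of_blaschke {f g l z : ℂ} (hf : Complex.normSq f < 1)
    (hg : Complex.normSq g < 1) (hl : Complex.normSq l = 1)
    (h : z * ((z - f) * (z - g)) = l * ((1 - conj f * z) * (1 - conj g * z))) :
    Complex.normSq z = 1 := by
  have h2 := congrArg Complex.normSq h
  simp only [Complex.normSq_mul, hl, one_mul] at h2
  have ef := normSq_sub_sub_normSq z f
  have eg := normSq_sub_sub_normSq z g
  have pz := Complex.normSq_nonneg z
  have p1 := Complex.normSq_nonneg (z - f)
  have p2 := Complex.normSq_nonneg (z - g)
  have p3 := Complex.normSq_nonneg (1 - conj f * z)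
  have p4 := Complex.normSq_nonneg (1 - conj g * z)
  generalize Complex.normSq z = Z at *
  generalize Complex.normSq f = F at *
  generalize Complex.normSq g = G at *
  generalize Complex.normSq (z - f) = A at *
  generalize Complex.normSq (z - g) = B at *
  generalize Complex.normSq (1 - conj f * z) = A' at *
  generalize Complex.normSq (1 - conj g * z) = B' at *
  by_contra hne
  rcases lt_or_gt_of_ne hne with hz | hz
  · have q1 : 0 < (1 - Z) * (1 - F) := mul_pos (by linarith) (by linarith)
    have q2 : 0 < (1 - Z) * (1 - G) := mul_pos (by linarith) (by linarith)
    have r1 : A * B ≤ A * B' := mul_le_mul_of_nonneg_left (by linarith) p1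
    have r2 : A * B' < A' * B' := mul_lt_mul_of_pos_right (by linarith) (by linarith)
    have r3 : Z * (A * B) ≤ 1 * (A * B) := mul_le_mul_of_nonneg_right hz.le (mul_nonneg p1 p2)
    linarith
  · have q1 : 0 < (Z - 1) * (1 - F) := mul_pos (by linarith) (by linarith)
    have q2 : 0 < (Z - 1) * (1 - G) := mul_pos (by linarith) (by linarith)
    have r1 : A' * B' ≤ A' * B := mul_le_mul_of_nonneg_left (by linarith) p3
    have r2 : A' * B < A * B := mul_lt_mul_of_pos_right (by linarith) (by linarith)
    have r3 : 1 * (A * B) ≤ Z * (A * B) := mul_le_mul_of_nonneg_right hz.le (mul_nonneg p1 p2)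
    linarith

/-- A triangle of a Poncelet family of triangles inscribed in the unit circle: `f`, `g` are the foci
of the caustic and `u`, `v`, `w` the vertices. -/
structure BlaschkeTriple (f g l u v w : ℂ) : Prop where
  hf : Complex.normSq f < 1
  hg : Complex.normSq g < 1
  hu : Complex.normSq u = 1
  hv : Complex.normSq v = 1
  hw : Complex.normSq w = 1
  s₁ : u + v + w = f + g + l * conj (f * g)
  s₂ : u * v + v * w + w * u = f * g + l * conj (f + g)
  s₃ : u * v * w = l

namespace BlaschkeTriple

variable {f g l u v w : ℂ}

theorem rotate (h : BlaschkeTriple f g l u v w) : BlaschkeTriple f g l v w u :=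
  ⟨h.hf, h.hg, h.hv, h.hw, h.hu, by rw [← h.s₁]; ring, by rw [← h.s₂]; ring, by rw [← h.s₃]; ring⟩

theorem mul_conj_eq_one {z : ℂ} (h : Complex.normSq z = 1) : z * conj z = 1 := by
  rw [Complex.mul_conj, h, Complex.ofReal_one]

theorem sub_ne_zero_of_normSq {z f : ℂ} (hz : Complex.normSq z = 1) (hf : Complex.normSq f < 1) :
    z - f ≠ 0 := by
  rintro h
  rw [sub_eq_zero.1 h] at hz
  linarith

/-- A positive real `β` with `β * (u - v) * (u - w) = n u`, where `n` is the monic quadratic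
polynomial interpolating the barycentric coordinates of `(f + g) / 2`. -/
theorem exists_weight (h : BlaschkeTriple f g l u v w) : ∃ β : ℝ, 0 < β ∧ u ≠ v ∧ u ≠ w ∧
    β * ((u - v) * (u - w)) = u ^ 2 - ((f + g) / 2 + l * conj (f * g)) * u +
      l * conj (f + g) / 2 := by
  have hu1 := mul_conj_eq_one h.hu
  have hf0 := sub_ne_zero_of_normSq h.hu h.hf
  have hg0 := sub_ne_zero_of_normSq h.hu h.hg
  have pf : 0 < Complex.normSq (u - f) := Complex.normSq_pos.2 hf0
  have pg : 0 < Complex.normSq (u - g) := Complex.normSq_pos.2 hg0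
  have hf := h.hf
  have hg := h.hg
  -- Multiplying `n u` and `(u - v) * (u - w)` by `conj (u - f) * conj (u - g)` makes both real and
  -- positive, namely `E` and `D`, so `β = E / D`.
  set E : ℝ := ((1 - Complex.normSq g) * Complex.normSq (u - f) +
    (1 - Complex.normSq f) * Complex.normSq (u - g)) / 2 with hE
  have hEpos : 0 < E := by
    have := mul_pos (sub_pos.2 hg) pf
    have := mul_pos (sub_pos.2 hf) pg
    positivity
  have hEc : (E : ℂ) = ((1 - g * conj g) * ((u - f) * conj (u - f)) +
      (1 - f * conj f) * ((u - g) * conj (u - g))) / 2 := by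
    simp only [Complex.mul_conj]
    rw [hE]
    push_cast
    ring
  set D : ℝ := Complex.normSq (u - f) * Complex.normSq (u - g) + 2 * E with hD
  have hDpos : 0 < D := by positivity
  have hDc : (D : ℂ) = ((u - f) * conj (u - f)) * ((u - g) * conj (u - g)) + 2 * E := by
    simp only [Complex.mul_conj]
    rw [hD]
    push_cast
    ring
  have hl : l * (conj (u - f) * conj (u - g)) = (u - f) * (u - g) * conj u := by
    have e : u ^ 3 - (u + v + w) * u ^ 2 + (u * v + v * w + w * u) * u - u * v * w = 0 := by ring
    rw [h.s₁, h.s₂, h.s₃] at e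
    simp only [map_sub, map_mul, map_add] at e ⊢
    linear_combination -e * conj u ^ 2 + (u ^ 2 * conj u - (f + g) * u * conj u -
      l * (conj f * conj g) * (u * conj u + 1) + f * g * conj u +
      l * (conj f + conj g) * conj u) * hu1
  have hn : (u ^ 2 - ((f + g) / 2 + l * conj (f * g)) * u + l * conj (f + g) / 2) *
      (conj (u - f) * conj (u - g)) = E := by
    rw [hEc]
    simp only [map_sub, map_mul, map_add] at hl ⊢
    have hu0 : u ≠ 0 := left_ne_zero_of_mul_eq_one hu1
    have hU : conj u = u⁻¹ := eq_inv_of_mul_eq_one_right hu1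
    rw [hU] at hl ⊢
    have e : (u ^ 2 - (f + g) / 2 * u) * ((u⁻¹ - conj f) * (u⁻¹ - conj g)) +
        ((conj f + conj g) / 2 - conj f * conj g * u) * ((u - f) * (u - g) * u⁻¹) =
        ((1 - g * conj g) * ((u - f) * (u⁻¹ - conj f)) +
        (1 - f * conj f) * ((u - g) * (u⁻¹ - conj g))) / 2 := by
      field_simp
      ring
    linear_combination e + ((conj f + conj g) / 2 - conj f * conj g * u) * hl
  have hp : (u - v) * (u - w) = (u - f) * (u - g) +
      2 * (u ^ 2 - ((f + g) / 2 + l * conj (f * g)) * u + l * conj (f + g) / 2) := by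
    have e : (u - v) * (u - w) = 3 * u ^ 2 - 2 * u * (u + v + w) + (u * v + v * w + w * u) := by
      ring
    rw [e, h.s₁, h.s₂]
    ring
  have hN0 : conj (u - f) * conj (u - g) ≠ 0 :=
    mul_ne_zero ((map_ne_zero _).2 hf0) ((map_ne_zero _).2 hg0)
  have hpD : (u - v) * (u - w) * (conj (u - f) * conj (u - g)) = D := by
    rw [hp, hDc]
    linear_combination 2 * hn
  have hDc0 : (D : ℂ) ≠ 0 := by exact_mod_cast hDpos.ne'
  have hne : (u - v) * (u - w) ≠ 0 := by
    intro h0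
    rw [h0, zero_mul] at hpD
    exact hDc0 hpD.symm
  refine ⟨E / D, by positivity, ?_, ?_, ?_⟩
  · rintro rfl
    simp at hne
  · rintro rfl
    simp at hne
  · apply mul_right_cancel₀ hN0
    rw [hn, mul_assoc, hpD]
    push_cast
    field_simp

/-- The midpoint of the foci is a positive convex combination of the vertices. -/
theorem exists_barycentric (h : BlaschkeTriple f g l u v w) :
    u ≠ v ∧ v ≠ w ∧ w ≠ u ∧ ∃ β₁ β₂ β₃ : ℝ, 0 < β₁ ∧ 0 < β₂ ∧ 0 < β₃ ∧ β₁ + β₂ + β₃ = 1 ∧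
      β₁ * u + β₂ * v + β₃ * w = (f + g) / 2 := by
  obtain ⟨β₁, p₁, uv, uw, e₁⟩ := h.exists_weight
  obtain ⟨β₂, p₂, vw, vu, e₂⟩ := h.rotate.exists_weight
  obtain ⟨β₃, p₃, wu, wv, e₃⟩ := h.rotate.rotate.exists_weight
  have hV : (u - v) * (v - w) * (w - u) ≠ 0 :=
    mul_ne_zero (mul_ne_zero (sub_ne_zero.2 uv) (sub_ne_zero.2 vw)) (sub_ne_zero.2 wu)
  have hs := h.s₁
  -- Lagrange interpolation at the vertices: `∑ n(u) / p'(u)` and `∑ u n(u) / p'(u)`, with `p` the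
  -- cubic having these roots, are read off the top coefficients of the monic quadratic `n`.
  refine ⟨uv, vw, wu, β₁, β₂, β₃, p₁, p₂, p₃, ?_, ?_⟩
  · have : (β₁ + β₂ + β₃ : ℂ) = 1 := by
      apply mul_left_cancel₀ hV
      linear_combination -(v - w) * e₁ - (w - u) * e₂ - (u - v) * e₃
    exact_mod_cast this
  · apply mul_left_cancel₀ hV
    linear_combination -(v - w) * u * e₁ - (w - u) * v * e₂ - (u - v) * w * e₃ +
      (u - v) * (v - w) * (w - u) * hs

end BlaschkeTriple

namespace BlaschkeTriple

/-- The symmetric functions say that the roots solve the Blaschke equation, so their unimodularity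
is automatic. -/
theorem of_roots {f g l u v w : ℂ} (hf : Complex.normSq f < 1)
    (hg : Complex.normSq g < 1) (hl : Complex.normSq l = 1)
    (s₁ : u + v + w = f + g + l * conj (f * g))
    (s₂ : u * v + v * w + w * u = f * g + l * conj (f + g)) (s₃ : u * v * w = l) :
    BlaschkeTriple f g l u v w := by
  have key : ∀ z : ℂ, (z - u) * (z - v) * (z - w) = 0 → Complex.normSq z = 1 := by
    intro z hz
    refine normSq_eq_one_of_blaschke hf hg hl ?_
    simp only [map_mul, map_add] at s₁ s₂
    linear_combination hz + z ^ 2 * s₁ - z * s₂ + s₃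
  exact ⟨hf, hg, key u (by ring), key v (by ring), key w (by ring), s₁, s₂, s₃⟩

theorem exists_of_prod {f g l : ℂ} (hf : Complex.normSq f < 1)
    (hg : Complex.normSq g < 1) (hl : Complex.normSq l = 1) :
    ∃ u v w, BlaschkeTriple f g l u v w := by
  obtain ⟨u, v, w, s₁, s₂, s₃⟩ := exists_roots (f + g + l * conj (f * g))
    (f * g + l * conj (f + g)) l
  exact ⟨u, v, w, of_roots hf hg hl s₁ s₂ s₃⟩

theorem exists_of_vertex {f g u : ℂ} (hf : Complex.normSq f < 1)
    (hg : Complex.normSq g < 1) (hu : Complex.normSq u = 1) :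
    ∃ l v w, Complex.normSq l = 1 ∧ BlaschkeTriple f g l u v w := by
  have e : ∀ h : ℂ, Complex.normSq h < 1 → 1 - conj h * u ≠ 0 ∧
      Complex.normSq (u - h) = Complex.normSq (1 - conj h * u) := by
    intro h hh
    have h1 := normSq_sub_sub_normSq u h
    rw [hu] at h1
    have h2 : Complex.normSq (u - h) = Complex.normSq (1 - conj h * u) := by linarith
    refine ⟨?_, h2⟩
    intro h0
    rw [h0, map_zero, Complex.normSq_eq_zero] at h2
    exact sub_ne_zero_of_normSq hu hh h2
  obtain ⟨nf, ef⟩ := e f hf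
  obtain ⟨ng, eg⟩ := e g hg
  -- The value of the Blaschke product at `u`, chosen so that `u` is one of the three roots.
  set l := u * ((u - f) * (u - g)) / ((1 - conj f * u) * (1 - conj g * u)) with hl
  have hl1 : l * ((1 - conj f * u) * (1 - conj g * u)) = u * ((u - f) * (u - g)) := by
    rw [hl, div_mul_cancel₀ _ (mul_ne_zero nf ng)]
  have hnl : Complex.normSq l = 1 := by
    have h1 := congrArg Complex.normSq hl1
    simp only [Complex.normSq_mul, hu, one_mul, ef, eg] at h1
    have h2 : Complex.normSq (1 - conj f * u) * Complex.normSq (1 - conj g * u) ≠ 0 :=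
      mul_ne_zero (by simpa using nf) (by simpa using ng)
    exact mul_right_cancel₀ h2 (by rw [h1, one_mul])
  obtain ⟨v, w, s₁, s₂, s₃⟩ := exists_roots_of_root (s₁ := f + g + l * conj (f * g))
    (s₂ := f * g + l * conj (f + g)) (s₃ := l) (u := u) (by
      simp only [map_mul, map_add]
      linear_combination -hl1)
  exact ⟨l, v, w, hnl, of_roots hf hg hnl s₁ s₂ s₃⟩

end BlaschkeTriple

/-! ### Tangency of chords and Vieta's formulas. -/

/-- In the coordinates in which the ellipse is the unit circle, the difference of the squared
distance from the centre `m` to the chord `u v` and `r ^ 2`, as a symmetric polynomial. -/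
theorem chord_identity {a b : ℝ} (ha : a ≠ 0) (hb : b ≠ 0) {u v : ℂ} (m : ℂ) (r : ℝ)
    (hu : Complex.normSq u = 1) (hv : Complex.normSq v = 1) :
    (((m + u * v * conj m - u - v) ^ 2 - 2 * ((r ^ 2 * (1 / a ^ 2 + 1 / b ^ 2) : ℝ) : ℂ) * (u * v) +
      ((r ^ 2 * (1 / b ^ 2 - 1 / a ^ 2) : ℝ) : ℂ) * (u ^ 2 * v ^ 2 + 1)) * (v - u) ^ 2) *
        (a ^ 2 * b ^ 2) = -4 * u ^ 2 * v ^ 2 *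
    ((((a * u.re - a * m.re) * (b * v.im - b * m.im) -
        (b * u.im - b * m.im) * (a * v.re - a * m.re)) ^ 2 -
      r ^ 2 * ((a * u.re - a * v.re) ^ 2 + (b * u.im - b * v.im) ^ 2) : ℝ) : ℂ) := by
  have hu1 := BlaschkeTriple.mul_conj_eq_one hu
  have hv1 := BlaschkeTriple.mul_conj_eq_one hv
  have hu0 : u ≠ 0 := left_ne_zero_of_mul_eq_one hu1
  have hv0 : v ≠ 0 := left_ne_zero_of_mul_eq_one hv1
  -- On the unit circle conjugation is inversion, so real and imaginary parts become rational
  -- functions.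
  have hU : conj u = u⁻¹ := eq_inv_of_mul_eq_one_right hu1
  have hV : conj v = v⁻¹ := eq_inv_of_mul_eq_one_right hv1
  have ha' : (a : ℂ) ≠ 0 := by exact_mod_cast ha
  have hb' : (b : ℂ) ≠ 0 := by exact_mod_cast hb
  have hI : Complex.I⁻¹ = -Complex.I := Complex.inv_I
  push_cast
  simp only [Complex.re_eq_add_conj, Complex.im_eq_sub_conj, hU, hV, div_eq_mul_inv, mul_inv, hI]
  generalize conj m = n
  field_simp
  ring_nf
  simp only [Complex.I_sq]
  ring

/-- The polynomial form of tangency of a chord. -/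
theorem chord_tangent_iff {a b : ℝ} (ha : a ≠ 0) (hb : b ≠ 0) {u v : ℂ} (m : ℂ) (r : ℝ)
    (hu : Complex.normSq u = 1) (hv : Complex.normSq v = 1) (huv : u ≠ v) :
    (m + u * v * conj m - u - v) ^ 2 - 2 * ((r ^ 2 * (1 / a ^ 2 + 1 / b ^ 2) : ℝ) : ℂ) * (u * v) +
      ((r ^ 2 * (1 / b ^ 2 - 1 / a ^ 2) : ℝ) : ℂ) * (u ^ 2 * v ^ 2 + 1) = 0 ↔
    ((a * u.re - a * m.re) * (b * v.im - b * m.im) -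
        (b * u.im - b * m.im) * (a * v.re - a * m.re)) ^ 2 =
      r ^ 2 * ((a * u.re - a * v.re) ^ 2 + (b * u.im - b * v.im) ^ 2) := by
  have key := chord_identity ha hb m r hu hv
  have hu0 : u ≠ 0 := by rintro rfl; simp at hu
  have hv0 : v ≠ 0 := by rintro rfl; simp at hv
  have ha' : (a : ℂ) ≠ 0 := by exact_mod_cast ha
  have hb' : (b : ℂ) ≠ 0 := by exact_mod_cast hb
  have hvu : v - u ≠ 0 := sub_ne_zero.2 huv.symm
  constructor
  · intro h
    rw [h, zero_mul, zero_mul, eq_comm, mul_eq_zero, Complex.ofReal_eq_zero] at key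
    exact sub_eq_zero.1 (key.resolve_left (by simp [hu0, hv0]))
  · intro h
    rw [h, sub_self, Complex.ofReal_zero, mul_zero] at key
    simpa [ha', hb', hvu] using key

/-- The symmetric functions of three points of the unit circle, any two of which are joined by a
tangent of the caustic, and the condition on the caustic. -/
theorem vieta_of_tangent {m n k ρ u v w : ℂ} (huv : u ≠ v) (hvw : v ≠ w) (hwu : w ≠ u)
    (hu : u ≠ 0) (hv : v ≠ 0)
    (h₁ : (m + u * v * n - u - v) ^ 2 - 2 * k * (u * v) + ρ * (u ^ 2 * v ^ 2 + 1) = 0)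
    (h₂ : (m + v * w * n - v - w) ^ 2 - 2 * k * (v * w) + ρ * (v ^ 2 * w ^ 2 + 1) = 0)
    (h₃ : (m + w * u * n - w - u) ^ 2 - 2 * k * (w * u) + ρ * (w ^ 2 * u ^ 2 + 1) = 0) :
    u + v + w = 2 * m + u * v * w * (n ^ 2 + ρ) ∧
    u * v + v * w + w * u = m ^ 2 + ρ + u * v * w * (2 * n) ∧
    1 - 2 * m * n - 2 * k + (m ^ 2 + ρ) * (n ^ 2 + ρ) = 0 := by
  -- For fixed `u`, tangency is a quadratic in the other endpoint with roots `v` and `w`; this is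
  -- the product of its roots, multiplied by `u`.
  have key : ∀ u v w : ℂ, v ≠ w →
      (m + u * v * n - u - v) ^ 2 - 2 * k * (u * v) + ρ * (u ^ 2 * v ^ 2 + 1) = 0 →
      (m + w * u * n - w - u) ^ 2 - 2 * k * (w * u) + ρ * (w ^ 2 * u ^ 2 + 1) = 0 →
      u * ((m - u) ^ 2 + ρ) = u * v * w * ((n * u - 1) ^ 2 + ρ * u ^ 2) := by
    intro u v w hvw h h'
    apply mul_left_cancel₀ (sub_ne_zero.2 hvw)
    linear_combination -u * (w * h - v * h')
  have c₁ := key u v w hvw h₁ h₃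
  have c₂ := key v w u hwu h₂ h₁
  have c₃ := key w u v huv h₃ h₂
  -- Each vertex solves the same cubic. Its difference from `(z - u) * (z - v) * (z - w)`, divided
  -- by `z`, is linear and vanishes at the distinct points `u` and `v`, so both coefficients vanish.
  have d : ∀ z : ℂ, z ≠ 0 → (z - u) * (z - v) * (z - w) = 0 →
      z * ((m - z) ^ 2 + ρ) = u * v * w * ((n * z - 1) ^ 2 + ρ * z ^ 2) →
      (u + v + w - (2 * m + u * v * w * (n ^ 2 + ρ))) * z =
        u * v + v * w + w * u - (m ^ 2 + ρ + u * v * w * (2 * n)) := by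
    intro z hz h0 h
    apply mul_left_cancel₀ hz
    linear_combination h - h0
  have d₁ := d u hu (by ring) c₁
  have d₂ := d v hv (by ring) (by linear_combination c₂)
  have e₁ : u + v + w = 2 * m + u * v * w * (n ^ 2 + ρ) := by
    apply sub_eq_zero.1
    apply mul_right_cancel₀ (sub_ne_zero.2 huv)
    linear_combination d₁ - d₂
  have e₂ : u * v + v * w + w * u = m ^ 2 + ρ + u * v * w * (2 * n) := by
    linear_combination -d₁ + u * e₁
  refine ⟨e₁, e₂, ?_⟩
  -- The sum of the roots of the quadratic at `u`; with the formulas above it becomes the Cayley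
  -- condition.
  have hB : (v + w) * ((n * u - 1) ^ 2 + ρ * u ^ 2) + 2 * (m - u) * (n * u - 1) - 2 * k * u = 0 := by
    apply mul_left_cancel₀ (sub_ne_zero.2 hvw)
    linear_combination h₁ - h₃
  apply mul_left_cancel₀ hu
  linear_combination hB - u * ((n ^ 2 + ρ) * e₂ - 2 * n * e₁) - e₁

/-- Vieta's formulas for the tangency quadratic at `u` are recovered as `hA` (product) and `hB`
(sum), so `v` is a root of it. -/
theorem tangent_of_vieta {m n k ρ u v w : ℂ} (hu : u ≠ 0)
    (e₁ : u + v + w = 2 * m + u * v * w * (n ^ 2 + ρ))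
    (e₂ : u * v + v * w + w * u = m ^ 2 + ρ + u * v * w * (2 * n))
    (e₃ : 1 - 2 * m * n - 2 * k + (m ^ 2 + ρ) * (n ^ 2 + ρ) = 0) :
    (m + u * v * n - u - v) ^ 2 - 2 * k * (u * v) + ρ * (u ^ 2 * v ^ 2 + 1) = 0 := by
  have hA : v * w * ((n * u - 1) ^ 2 + ρ * u ^ 2) = (m - u) ^ 2 + ρ := by
    apply mul_left_cancel₀ hu
    linear_combination -u ^ 2 * e₁ + u * e₂
  have hB : (v + w) * ((n * u - 1) ^ 2 + ρ * u ^ 2) + 2 * (m - u) * (n * u - 1) - 2 * k * u = 0 := by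
    linear_combination u * e₃ + u * ((n ^ 2 + ρ) * e₂ - 2 * n * e₁) + e₁
  linear_combination v * hB - hA

/-! ### From the unit circle back to the ellipse. -/

/-- The point of the ellipse corresponding to a point of the unit circle. -/
noncomputable def ellipsePoint (a b : ℝ) (u : ℂ) : Plane := !₂[a * u.re, b * u.im]

@[simp] theorem ellipsePoint_zero (a b : ℝ) (u : ℂ) : ellipsePoint a b u 0 = a * u.re := rfl

@[simp] theorem ellipsePoint_one (a b : ℝ) (u : ℂ) : ellipsePoint a b u 1 = b * u.im := rfl

theorem ellipsePoint_mem_iff {a b : ℝ} (ha : a ≠ 0) (hb : b ≠ 0) {u : ℂ} :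
    ellipsePoint a b u ∈ ellipse a b ↔ Complex.normSq u = 1 := by
  simp only [ellipse, Set.mem_ofPred_eq, ellipsePoint_zero, ellipsePoint_one,
    Complex.normSq_apply]
  rw [mul_pow, mul_pow, mul_div_cancel_left₀ _ (pow_ne_zero 2 ha),
    mul_div_cancel_left₀ _ (pow_ne_zero 2 hb), sq, sq]

theorem exists_ellipsePoint_eq {a b : ℝ} (ha : a ≠ 0) (hb : b ≠ 0) (p : Plane) :
    ∃ u, p = ellipsePoint a b u :=
  ⟨⟨p 0 / a, p 1 / b⟩, Plane.ext (by simp; field) (by simp; field)⟩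

theorem exists_of_mem_ellipse {a b : ℝ} (ha : a ≠ 0) (hb : b ≠ 0) {p : Plane}
    (hp : p ∈ ellipse a b) : ∃ u, Complex.normSq u = 1 ∧ p = ellipsePoint a b u := by
  obtain ⟨u, rfl⟩ := exists_ellipsePoint_eq ha hb p
  exact ⟨u, (ellipsePoint_mem_iff ha hb).1 hp, rfl⟩

theorem exists_of_inscribed {a b : ℝ} (ha : a ≠ 0) (hb : b ≠ 0) {T : PlaneTriangle}
    (hT : InscribedInEllipse a b T) : ∃ u v w : ℂ,
      Complex.normSq u = 1 ∧ Complex.normSq v = 1 ∧ Complex.normSq w = 1 ∧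
      u ≠ v ∧ v ≠ w ∧ w ≠ u ∧ T.points 0 = ellipsePoint a b u ∧
      T.points 1 = ellipsePoint a b v ∧ T.points 2 = ellipsePoint a b w := by
  obtain ⟨u, hu, eu⟩ := exists_of_mem_ellipse ha hb (hT 0)
  obtain ⟨v, hv, ev⟩ := exists_of_mem_ellipse ha hb (hT 1)
  obtain ⟨w, hw, ew⟩ := exists_of_mem_ellipse ha hb (hT 2)
  have hi := T.independent.injective
  refine ⟨u, v, w, hu, hv, hw, ?_, ?_, ?_, eu, ev, ew⟩
  · rintro rfl
    exact absurd (hi (eu.trans ev.symm)) (by decide)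
  · rintro rfl
    exact absurd (hi (ev.trans ew.symm)) (by decide)
  · rintro rfl
    exact absurd (hi (ew.trans eu.symm)) (by decide)

/-- The circumcenter of a triangle inscribed in an ellipse. -/
theorem circumcenter_of_inscribed {a b : ℝ} (ha : a ≠ 0) (hb : b ≠ 0) {T : PlaneTriangle}
    {u v w : ℂ} (hu : Complex.normSq u = 1) (hv : Complex.normSq v = 1)
    (hw : Complex.normSq w = 1) (eu : T.points 0 = ellipsePoint a b u)
    (ev : T.points 1 = ellipsePoint a b v) (ew : T.points 2 = ellipsePoint a b w) :
    4 * a * T.circumcenter 0 = (a ^ 2 - b ^ 2) * ((u + v + w).re + (u * v * w).re) ∧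
    4 * b * T.circumcenter 1 = -((a ^ 2 - b ^ 2) * ((u + v + w).im - (u * v * w).im)) := by
  set s := u + v + w with hs
  set l := u * v * w with hl
  set O : Plane := !₂[(a ^ 2 - b ^ 2) * (s.re + l.re) / (4 * a),
    -((a ^ 2 - b ^ 2) * (s.im - l.im)) / (4 * b)] with hO
  have e0 : O 0 = (a ^ 2 - b ^ 2) * (s.re + l.re) / (4 * a) := rfl
  have e1 : O 1 = -((a ^ 2 - b ^ 2) * (s.im - l.im)) / (4 * b) := rfl
  have key : ∀ z : ℂ, Complex.normSq z = 1 → (z - u) * (z - v) * (z - w) = 0 →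
      dist (ellipsePoint a b z) O = √((a ^ 2 + b ^ 2) / 2 -
        (a ^ 2 - b ^ 2) / 2 * (u * v + v * w + w * u).re + (O 0 ^ 2 + O 1 ^ 2)) := by
    intro z hz h
    have f0 : 4 * a * O 0 = (a ^ 2 - b ^ 2) * (s.re + l.re) := by rw [e0]; field
    have f1 : 4 * b * O 1 = -((a ^ 2 - b ^ 2) * (s.im - l.im)) := by rw [e1]; field
    have hc : z ^ 2 - s * z - l * conj z + (u * v + v * w + w * u) = 0 := by
      rw [hs, hl]
      linear_combination conj z * h - (z ^ 2 - (u + v + w) * z + (u * v + v * w + w * u)) *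
        BlaschkeTriple.mul_conj_eq_one hz
    have hre := congrArg Complex.re hc
    rw [Complex.normSq_apply] at hz
    simp only [Complex.add_re, Complex.sub_re, sq, Complex.mul_re s z, Complex.mul_re z z,
      Complex.mul_re l, Complex.conj_re, Complex.conj_im, Complex.zero_re] at hre
    rw [← Real.sqrt_sq (dist_nonneg (x := ellipsePoint a b z) (y := O)), Plane.dist_sq,
      ellipsePoint_zero, ellipsePoint_one]
    congr 1
    simp only [Complex.add_re]
    linear_combination -z.re / 2 * f0 - z.im / 2 * f1 + (a ^ 2 - b ^ 2) / 2 * hre +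
      (a ^ 2 + b ^ 2) / 2 * hz
  have hc : O = T.circumcenter := by
    refine T.eq_circumcenter (eu ▸ key u hu (by ring)) (ev ▸ key v hv (by ring))
      (ew ▸ key w hw (by ring))
  rw [← hc, e0, e1]
  constructor <;> field

/-- The triangle with vertices on an ellipse given by three points of the unit circle with the
chords tangent to a circle whose centre has positive barycentric coordinates. -/
theorem exists_interscribed {a b : ℝ} (ha : 0 < a) (hb : 0 < b) {f g l u v w : ℂ}
    (h : BlaschkeTriple f g l u v w) {m : ℂ} {r : ℝ} (hr : 0 < r) (hm : f + g = 2 * m)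
    (hp : f * g = m ^ 2 + ((r ^ 2 * (1 / b ^ 2 - 1 / a ^ 2) : ℝ) : ℂ))
    (hk : 1 - 2 * m * conj m - 2 * ((r ^ 2 * (1 / a ^ 2 + 1 / b ^ 2) : ℝ) : ℂ) +
      (f * g) * conj (f * g) = 0) :
    ∃ T ∈ interscribed a b (ellipsePoint a b m) r, T.points 0 = ellipsePoint a b u ∧
      T.points 1 = ellipsePoint a b v ∧ T.points 2 = ellipsePoint a b w := by
  obtain ⟨uv, vw, wu, β₁, β₂, β₃, p₁, p₂, p₃, hs, hβ⟩ := h.exists_barycentric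
  have hmβ : β₁ * u + β₂ * v + β₃ * w = m := by rw [hβ, hm]; ring
  have e₁ := h.s₁
  have e₂ := h.s₂
  rw [hp] at hk
  rw [hm, hp, ← h.s₃] at e₁
  rw [hm, hp, ← h.s₃] at e₂
  simp only [map_mul, map_add, map_pow, Complex.conj_ofReal, map_ofNat] at e₁ e₂ hk
  have n0 : ∀ z : ℂ, Complex.normSq z = 1 → z ≠ 0 := by
    rintro z hz rfl
    simp at hz
  have t₁ := (chord_tangent_iff ha.ne' hb.ne' m r h.hu h.hv uv).1
    (tangent_of_vieta (n0 u h.hu) e₁ e₂ hk)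
  have t₂ := (chord_tangent_iff ha.ne' hb.ne' m r h.hv h.hw vw).1
    (tangent_of_vieta (u := v) (v := w) (w := u) (n0 v h.hv) (by linear_combination e₁)
      (by linear_combination e₂) hk)
  have t₃ := (chord_tangent_iff ha.ne' hb.ne' m r h.hw h.hu wu).1
    (tangent_of_vieta (u := w) (v := u) (w := v) (n0 w h.hw) (by linear_combination e₁)
      (by linear_combination e₂) hk)
  have hre := congrArg Complex.re hmβ
  have him := congrArg Complex.im hmβ
  simp only [Complex.add_re, Complex.add_im, Complex.re_ofReal_mul, Complex.im_ofReal_mul]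
    at hre him
  set X : ℝ := (a * v.re - a * u.re) * (b * w.im - b * u.im) -
    (b * v.im - b * u.im) * (a * w.re - a * u.re) with hX
  -- The centre cuts off signed areas proportional to its barycentric coordinates; their positivity
  -- later gives the incenter rather than an excenter.
  have x₁ : (a * v.re - a * m.re) * (b * w.im - b * m.im) -
        (b * v.im - b * m.im) * (a * w.re - a * m.re) = β₁ * X := by
    linear_combination -a * b * ((v.im - w.im) * hre + (w.re - v.re) * him +
      (v.re * w.im - v.im * w.re) * hs)
  have x₂ : (a * w.re - a * m.re) * (b * u.im - b * m.im) -
        (b * w.im - b * m.im) * (a * u.re - a * m.re) = β₂ * X := by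
    linear_combination -a * b * ((w.im - u.im) * hre + (u.re - w.re) * him +
      (w.re * u.im - w.im * u.re) * hs)
  have x₃ : (a * u.re - a * m.re) * (b * v.im - b * m.im) -
        (b * u.im - b * m.im) * (a * v.re - a * m.re) = β₃ * X := by
    linear_combination -a * b * ((u.im - v.im) * hre + (v.re - u.re) * him +
      (u.re * v.im - u.im * v.re) * hs)
  rw [x₃] at t₁
  rw [x₁] at t₂
  rw [x₂] at t₃
  have hX0 : X ≠ 0 := by
    intro h0
    rw [h0, mul_zero] at t₁
    have h1 : (a * u.re - a * v.re) ^ 2 + (b * u.im - b * v.im) ^ 2 = 0 := by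
      have : r ^ 2 ≠ 0 := by positivity
      simpa [this, eq_comm] using t₁
    have h2 := sq_nonneg (a * u.re - a * v.re)
    have h3 := sq_nonneg (b * u.im - b * v.im)
    have h4 : a * u.re - a * v.re = 0 := (pow_eq_zero_iff two_ne_zero).1 (by linarith)
    have h5 : b * u.im - b * v.im = 0 := (pow_eq_zero_iff two_ne_zero).1 (by linarith)
    exact uv (Complex.ext (mul_left_cancel₀ ha.ne' (sub_eq_zero.1 h4))
      (mul_left_cancel₀ hb.ne' (sub_eq_zero.1 h5)))
  obtain ⟨T, T0, T1, T2⟩ := PlaneTriangle.exists_points_eq (p₀ := ellipsePoint a b u)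
    (p₁ := ellipsePoint a b v) (p₂ := ellipsePoint a b w) (by simpa using hX0)
  have hTX : T.cross = X := by
    rw [PlaneTriangle.cross, T0, T1, T2]
    simp only [ellipsePoint_zero, ellipsePoint_one, hX]
  have hd : ∀ {β : ℝ} {z z' : ℂ}, 0 < β →
      (β * X) ^ 2 = r ^ 2 * ((a * z.re - a * z'.re) ^ 2 + (b * z.im - b * z'.im) ^ 2) →
      β * |T.cross| = r * dist (ellipsePoint a b z) (ellipsePoint a b z') := by
    intro β z z' hβ h
    have := Plane.dist_sq (ellipsePoint a b z) (ellipsePoint a b z')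
    simp only [ellipsePoint_zero, ellipsePoint_one] at this
    rw [← this, ← mul_pow, sq_eq_sq_iff_abs_eq_abs, abs_mul, abs_of_pos hβ,
      abs_of_nonneg (mul_nonneg hr.le dist_nonneg)] at h
    rwa [hTX]
  have hin := T.incenter_eq (C := ellipsePoint a b m) (r := r) hs (by
    intro k
    rw [T0, T1, T2]
    fin_cases k
    · simp only [Fin.zero_eta, Fin.isValue, ellipsePoint_zero]
      linear_combination -a * hre
    · simp only [Fin.mk_one, Fin.isValue, ellipsePoint_one]
      linear_combination -b * him) (by rw [T1, T2]; exact hd p₁ t₂)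
      (by rw [T2, T0]; exact hd p₂ t₃) (by rw [T0, T1]; exact hd p₃ t₁)
  refine ⟨T, ⟨?_, hin⟩, T0, T1, T2⟩
  intro i
  fin_cases i
  · exact T0 ▸ (ellipsePoint_mem_iff ha.ne' hb.ne').2 h.hu
  · exact T1 ▸ (ellipsePoint_mem_iff ha.ne' hb.ne').2 h.hv
  · exact T2 ▸ (ellipsePoint_mem_iff ha.ne' hb.ne').2 h.hw

/-- The inequality, which comes from `IncenterGram.moment_gt` along both axes, serves to exclude the
other root of the Cayley condition. -/
theorem interscribed_vieta {a b : ℝ} (ha : 0 < a) (hb : 0 < b) {m : ℂ} {r : ℝ} {T : PlaneTriangle}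
    (hT : T ∈ interscribed a b (ellipsePoint a b m) r) :
    0 < r ∧ r ^ 2 * (1 / a ^ 2 + 1 / b ^ 2) < 1 - Complex.normSq m ∧
    1 - 2 * m * conj m - 2 * ((r ^ 2 * (1 / a ^ 2 + 1 / b ^ 2) : ℝ) : ℂ) +
      (m ^ 2 + ((r ^ 2 * (1 / b ^ 2 - 1 / a ^ 2) : ℝ) : ℂ)) *
      (conj m ^ 2 + ((r ^ 2 * (1 / b ^ 2 - 1 / a ^ 2) : ℝ) : ℂ)) = 0 ∧
    ∃ u v w : ℂ, Complex.normSq u = 1 ∧ Complex.normSq v = 1 ∧ Complex.normSq w = 1 ∧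
      T.points 0 = ellipsePoint a b u ∧ T.points 1 = ellipsePoint a b v ∧
      T.points 2 = ellipsePoint a b w ∧ u + v + w = 2 * m +
        u * v * w * (conj m ^ 2 + ((r ^ 2 * (1 / b ^ 2 - 1 / a ^ 2) : ℝ) : ℂ)) := by
  obtain ⟨hin, hinc, hrad⟩ := hT
  obtain ⟨u, v, w, hu, hv, hw, uv, vw, wu, eu, ev, ew⟩ := exists_of_inscribed ha.ne' hb.ne' hin
  have h := T.incenterGram
  have hr := h.posr
  rw [hinc, hrad, eu, ev, ew] at h
  have d₁ := Plane.dist_sq (ellipsePoint a b v) (ellipsePoint a b w)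
  have d₂ := Plane.dist_sq (ellipsePoint a b w) (ellipsePoint a b u)
  have d₃ := Plane.dist_sq (ellipsePoint a b u) (ellipsePoint a b v)
  simp only [ellipsePoint_zero, ellipsePoint_one] at h d₁ d₂ d₃
  have n0 : ∀ z : ℂ, Complex.normSq z = 1 → z ≠ 0 := by
    rintro z hz rfl
    simp at hz
  have t₁ := (chord_tangent_iff ha.ne' hb.ne' m r hu hv uv).2 (by
    linear_combination h.cross_sq + r ^ 2 * d₃)
  have t₂ := (chord_tangent_iff ha.ne' hb.ne' m r hv hw vw).2 (by
    linear_combination h.rotate.cross_sq + r ^ 2 * d₁)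
  have t₃ := (chord_tangent_iff ha.ne' hb.ne' m r hw hu wu).2 (by
    linear_combination h.rotate.rotate.cross_sq + r ^ 2 * d₂)
  obtain ⟨e₁, -, e₃⟩ := vieta_of_tangent uv vw wu (n0 u hu) (n0 v hv) t₁ t₂ t₃
  rw [hrad] at hr
  refine ⟨hr, ?_, e₃, u, v, w, hu, hv, hw, eu, ev, ew, e₁⟩
  have m₁ := h.moment_gt
  have m₂ := h.swap.moment_gt
  have b₁ := h.bary_p
  have b₂ := h.bary_q
  have hx := h.posx
  have hy := h.posy
  have hz := h.posz
  rw [Complex.normSq_apply] at hu hv hw ⊢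
  generalize dist (ellipsePoint a b v) (ellipsePoint a b w) = l₁ at *
  generalize dist (ellipsePoint a b w) (ellipsePoint a b u) = l₂ at *
  generalize dist (ellipsePoint a b u) (ellipsePoint a b v) = l₃ at *
  have hS : 0 < l₁ + l₂ + l₃ := by linarith
  have M₁ : r ^ 2 * (l₁ + l₂ + l₃) / a ^ 2 <
      l₁ * (u.re - m.re) ^ 2 + l₂ * (v.re - m.re) ^ 2 + l₃ * (w.re - m.re) ^ 2 := by
    rw [div_lt_iff₀ (by positivity)]
    linarith
  have M₂ : r ^ 2 * (l₁ + l₂ + l₃) / b ^ 2 <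
      l₁ * (u.im - m.im) ^ 2 + l₂ * (v.im - m.im) ^ 2 + l₃ * (w.im - m.im) ^ 2 := by
    rw [div_lt_iff₀ (by positivity)]
    linarith
  have B₁ : l₁ * (u.re - m.re) + l₂ * (v.re - m.re) + l₃ * (w.re - m.re) = 0 := by
    apply mul_left_cancel₀ ha.ne'
    linear_combination b₁
  have B₂ : l₁ * (u.im - m.im) + l₂ * (v.im - m.im) + l₃ * (w.im - m.im) = 0 := by
    apply mul_left_cancel₀ hb.ne'
    linear_combination b₂
  -- Parallel axis theorem: `m` is the centre of mass of unimodular points with masses the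
  -- sidelengths.
  have key : (l₁ + l₂ + l₃) * (1 - (m.re * m.re + m.im * m.im)) =
      l₁ * (u.re - m.re) ^ 2 + l₂ * (v.re - m.re) ^ 2 + l₃ * (w.re - m.re) ^ 2 +
      (l₁ * (u.im - m.im) ^ 2 + l₂ * (v.im - m.im) ^ 2 + l₃ * (w.im - m.im) ^ 2) := by
    linear_combination 2 * m.re * B₁ + 2 * m.im * B₂ - l₁ * hu - l₂ * hv - l₃ * hw
  apply lt_of_mul_lt_mul_left _ hS.le
  rw [key]
  refine lt_of_eq_of_lt ?_ (add_lt_add M₁ M₂)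
  ring

/-! ### Uniqueness of the radius and position of the foci. -/

theorem radius_unique {m : ℂ} {h k R R' : ℝ} (hk : 0 < k) (hkh : k ≤ h)
    (hR : 0 < R) (hR' : 0 < R') (hlt : R * h < 1 - Complex.normSq m)
    (hlt' : R' * h < 1 - Complex.normSq m)
    (e : 1 - 2 * m * conj m - 2 * ((R * h : ℝ) : ℂ) +
      (m ^ 2 + ((R * k : ℝ) : ℂ)) * (conj m ^ 2 + ((R * k : ℝ) : ℂ)) = 0)
    (e' : 1 - 2 * m * conj m - 2 * ((R' * h : ℝ) : ℂ) +
      (m ^ 2 + ((R' * k : ℝ) : ℂ)) * (conj m ^ 2 + ((R' * k : ℝ) : ℂ)) = 0) : R = R' := by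
  -- Distinct roots of the Cayley quadratic would satisfy `(R * k) * (R' * k) = (1 - |m|²) ^ 2`, but
  -- both factors are below `1 - |m|²`.
  have key : (R' - R) * ((1 - Complex.normSq m) ^ 2 - (R * k) * (R' * k)) = 0 := by
    have : (((R' - R) * ((1 - Complex.normSq m) ^ 2 - (R * k) * (R' * k)) : ℝ) : ℂ) = 0 := by
      push_cast at e e' ⊢
      rw [← Complex.mul_conj]
      linear_combination R' * e - R * e'
    exact_mod_cast this
  have h1 : R * k ≤ R * h := mul_le_mul_of_nonneg_left hkh hR.le
  have h2 : R' * k ≤ R' * h := mul_le_mul_of_nonneg_left hkh hR'.le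
  have h3 : (R * k) * (R' * k) < (1 - Complex.normSq m) ^ 2 := by
    rw [sq]
    exact mul_lt_mul'' (by linarith) (by linarith) (by positivity) (by positivity)
  rcases mul_eq_zero.1 key with h4 | h4 <;> linarith

/-- The foci of the caustic lie inside the unit circle. -/
theorem normSq_focus_lt_one {m : ℂ} {h k R ρ : ℝ} (hkh : k < h) (hR : 0 < R)
    (hlt : R * h < 1 - Complex.normSq m) (hρ : ρ ^ 2 = R * k)
    (e : 1 - 2 * m * conj m - 2 * ((R * h : ℝ) : ℂ) +
      (m ^ 2 + ((R * k : ℝ) : ℂ)) * (conj m ^ 2 + ((R * k : ℝ) : ℂ)) = 0) :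
    Complex.normSq (m + ρ * Complex.I) < 1 ∧ Complex.normSq (m - ρ * Complex.I) < 1 := by
  have e' := congrArg Complex.re e
  simp only [Complex.normSq_apply, Complex.add_re, Complex.sub_re, Complex.mul_re, Complex.mul_im,
    Complex.one_re, Complex.ofReal_re, Complex.ofReal_im, Complex.conj_re, Complex.conj_im,
    Complex.re_ofNat, Complex.im_ofNat, sq, Complex.add_im, Complex.sub_im, Complex.I_re,
    Complex.I_im, Complex.zero_re] at e' hlt hρ ⊢
  set x := m.re
  set y := m.im
  have h1 : R * k < R * h := mul_lt_mul_of_pos_left hkh hR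
  have hsum : 0 < (1 - (x * x + (y + ρ) * (y + ρ))) + (1 - (x * x + (y - ρ) * (y - ρ))) := by
    linarith
  have hprod : 0 < (1 - (x * x + (y + ρ) * (y + ρ))) * (1 - (x * x + (y - ρ) * (y - ρ))) := by
    -- The Cayley condition evaluates `(1 - |f|²) (1 - |g|²)`; with a positive sum, both factors are
    -- positive.
    have : (1 - (x * x + (y + ρ) * (y + ρ))) * (1 - (x * x + (y - ρ) * (y - ρ))) =
        2 * (R * h - R * k) := by
      linear_combination e' + (2 * (x * x) - 2 * (y * y) - 2 + ρ * ρ + R * k) * hρ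
    linarith
  rcases mul_pos_iff.1 hprod with h2 | h2
  · constructor <;> linarith [h2.1, h2.2]
  · linarith [h2.1, h2.2]

/-! ### Coinciding centres of equilateral triangles. -/

theorem centroid_eq_circumcenter_of_equilateral (T : PlaneTriangle) (h : T.Equilateral) :
    T.centroid = T.circumcenter := by
  obtain ⟨l, hl⟩ := h
  have d : ∀ i j : Fin 3, i ≠ j →
      (T.points i 0 - T.points j 0) ^ 2 + (T.points i 1 - T.points j 1) ^ 2 = l ^ 2 :=
    fun i j hij => by rw [← Plane.dist_sq, hl i j hij]
  have g0 := T.three_mul_centroid 0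
  have g1 := T.three_mul_centroid 1
  have key : ∀ i, dist (T.points i) T.centroid ^ 2 = l ^ 2 / 3 →
      dist (T.points i) T.centroid = √(l ^ 2 / 3) := by
    intro i hi
    rw [← hi, Real.sqrt_sq dist_nonneg]
  have e0 : T.centroid 0 = (T.points 0 0 + T.points 1 0 + T.points 2 0) / 3 := by linarith
  have e1 : T.centroid 1 = (T.points 0 1 + T.points 1 1 + T.points 2 1) / 3 := by linarith
  refine T.eq_circumcenter (key 0 ?_) (key 1 ?_) (key 2 ?_) <;> rw [Plane.dist_sq, e0, e1]
  · linear_combination (2 * d 0 1 (by decide) + 2 * d 0 2 (by decide) - d 1 2 (by decide)) / 9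
  · linear_combination (2 * d 0 1 (by decide) + 2 * d 1 2 (by decide) - d 0 2 (by decide)) / 9
  · linear_combination (2 * d 1 2 (by decide) + 2 * d 0 2 (by decide) - d 0 1 (by decide)) / 9

theorem centroid_eq_incenter_of_equilateral (T : PlaneTriangle) (h : T.Equilateral) :
    T.centroid = T.incenter := by
  obtain ⟨h1, h2⟩ := T.equilateral_iff.1 h
  have hp := T.dist_pos (i := 0) (j := 1) (by decide)
  have key : ∀ k, T.centroid k = T.incenter k := by
    intro k
    have hm := T.mul_incenter k
    have hg := T.three_mul_centroid k
    rw [h1, h2] at hm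
    apply mul_left_cancel₀ hp.ne'
    linear_combination (dist (T.points 0) (T.points 1) * hg - hm) / 3
  exact Plane.ext (key 0) (key 1)

/-! ### The caustics centred on the centroid locus. -/

/-- The centre of the caustic in the coordinates in which the ellipse is the unit circle. -/
noncomputable def causticCenter (a b t : ℝ) : ℂ :=
  ⟨(a ^ 2 - b ^ 2) / (a ^ 2 + 3 * b ^ 2) * Real.cos t,
    (a ^ 2 - b ^ 2) / (3 * a ^ 2 + b ^ 2) * Real.sin t⟩

/-- The squared radius of the caustic. -/
noncomputable def causticRadiusSq (a b t : ℝ) : ℝ :=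
  4 * a ^ 2 * b ^ 2 * (b ^ 2 * Real.cos t ^ 2 / (a ^ 2 + 3 * b ^ 2) ^ 2 +
    a ^ 2 * Real.sin t ^ 2 / (3 * a ^ 2 + b ^ 2) ^ 2)

/-- The point of the unit circle with argument `t`. -/
noncomputable def unitPoint (t : ℝ) : ℂ := ⟨Real.cos t, Real.sin t⟩

theorem normSq_unitPoint (t : ℝ) : Complex.normSq (unitPoint t) = 1 := by
  rw [Complex.normSq_apply, unitPoint]
  linear_combination Real.cos_sq_add_sin_sq t

theorem ellipsePoint_causticCenter (a b t : ℝ) :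
    ellipsePoint a b (causticCenter a b t) = !₂[aTri a b * Real.cos t, bTri a b * Real.sin t] := by
  rw [ellipsePoint, causticCenter, aTri, bTri]
  congr 2
  · ring
  · congr 1
    ring

theorem causticRadiusSq_pos {a b : ℝ} (hb : 0 < b) (hab : b < a) (t : ℝ) :
    0 < causticRadiusSq a b t := by
  have ha : 0 < a := hb.trans hab
  have h := Real.cos_sq_add_sin_sq t
  have h1 : 0 < b ^ 2 / (a ^ 2 + 3 * b ^ 2) ^ 2 := by positivity
  have h2 : 0 < a ^ 2 / (3 * a ^ 2 + b ^ 2) ^ 2 := by positivity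
  have hc := sq_nonneg (Real.cos t)
  have hs := sq_nonneg (Real.sin t)
  rw [causticRadiusSq]
  refine mul_pos (by positivity) ?_
  rcases hc.lt_or_eq with hc | hc
  · exact add_pos_of_pos_of_nonneg (by positivity) (by positivity)
  · have : 0 < Real.sin t ^ 2 := by linarith
    exact add_pos_of_nonneg_of_pos (by positivity) (by positivity)

/-- The left side is the product of the foci. This identity gives it the modulus of the centre,
which simplifies the Cayley condition, and makes the vertex sum a multiple of the centre. -/
theorem causticCenter_sq_add {a b : ℝ} (hb : 0 < b) (hab : b < a) (t : ℝ) :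
    causticCenter a b t ^ 2 + ((causticRadiusSq a b t * (1 / b ^ 2 - 1 / a ^ 2) : ℝ) : ℂ) =
      conj (causticCenter a b t) * unitPoint t := by
  have ha : 0 < a := hb.trans hab
  have h1 : a ^ 2 + 3 * b ^ 2 ≠ 0 := by positivity
  have h2 : 3 * a ^ 2 + b ^ 2 ≠ 0 := by positivity
  apply Complex.ext
  · simp only [sq, Complex.add_re, Complex.mul_re, Complex.conj_re, Complex.conj_im,
      Complex.ofReal_re, causticCenter, causticRadiusSq, unitPoint]
    field
  · simp only [sq, Complex.add_im, Complex.mul_im, Complex.conj_re, Complex.conj_im,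
      Complex.ofReal_im, causticCenter, unitPoint]
    field

theorem one_sub_normSq_causticCenter {a b : ℝ} (hb : 0 < b) (hab : b < a) (t : ℝ) :
    1 - Complex.normSq (causticCenter a b t) =
      2 * (causticRadiusSq a b t * (1 / a ^ 2 + 1 / b ^ 2)) := by
  have ha : 0 < a := hb.trans hab
  have h1 : a ^ 2 + 3 * b ^ 2 ≠ 0 := by positivity
  have h2 : 3 * a ^ 2 + b ^ 2 ≠ 0 := by positivity
  -- Replacing `1` by `cos² + sin²` makes the claim a rational identity with `cos t` and `sin t`
  -- independent.
  have key : Real.cos t ^ 2 + Real.sin t ^ 2 - Complex.normSq (causticCenter a b t) =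
      2 * (causticRadiusSq a b t * (1 / a ^ 2 + 1 / b ^ 2)) := by
    simp only [Complex.normSq_apply, causticCenter, causticRadiusSq]
    field
  rwa [Real.cos_sq_add_sin_sq] at key

theorem cayley_causticCenter {a b : ℝ} (hb : 0 < b) (hab : b < a) (t : ℝ) :
    1 - 2 * causticCenter a b t * conj (causticCenter a b t) -
      2 * ((causticRadiusSq a b t * (1 / a ^ 2 + 1 / b ^ 2) : ℝ) : ℂ) +
      (causticCenter a b t ^ 2 + ((causticRadiusSq a b t * (1 / b ^ 2 - 1 / a ^ 2) : ℝ) : ℂ)) *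
      (conj (causticCenter a b t) ^ 2 +
        ((causticRadiusSq a b t * (1 / b ^ 2 - 1 / a ^ 2) : ℝ) : ℂ)) = 0 := by
  have h1 := causticCenter_sq_add hb hab t
  have h2 := congrArg conj h1
  rw [map_add, map_pow, map_mul, Complex.conj_conj, Complex.conj_ofReal] at h2
  have h3 : (1 : ℂ) - causticCenter a b t * conj (causticCenter a b t) =
      2 * ((causticRadiusSq a b t * (1 / a ^ 2 + 1 / b ^ 2) : ℝ) : ℂ) := by
    rw [Complex.mul_conj]
    exact_mod_cast congrArg (fun x : ℝ => (x : ℂ)) (one_sub_normSq_causticCenter hb hab t)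
  rw [h1, h2]
  linear_combination h3 + causticCenter a b t * conj (causticCenter a b t) *
    BlaschkeTriple.mul_conj_eq_one (normSq_unitPoint t)

theorem causticRadiusSq_mul_lt {a b : ℝ} (hb : 0 < b) (hab : b < a) (t : ℝ) :
    causticRadiusSq a b t * (1 / a ^ 2 + 1 / b ^ 2) < 1 - Complex.normSq (causticCenter a b t) := by
  have ha : 0 < a := hb.trans hab
  have := causticRadiusSq_pos hb hab t
  rw [one_sub_normSq_causticCenter hb hab]
  have : 0 < causticRadiusSq a b t * (1 / a ^ 2 + 1 / b ^ 2) := by positivity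
  linarith

theorem one_div_sq_sub_pos {a b : ℝ} (hb : 0 < b) (hab : b < a) : 0 < 1 / b ^ 2 - 1 / a ^ 2 :=
  sub_pos.2 (one_div_lt_one_div_of_lt (by positivity) (pow_lt_pow_left₀ hab hb.le two_ne_zero))

theorem one_div_sq_sub_lt {a b : ℝ} (hb : 0 < b) (hab : b < a) :
    1 / b ^ 2 - 1 / a ^ 2 < 1 / a ^ 2 + 1 / b ^ 2 := by
  have ha : 0 < a := hb.trans hab
  have : 0 < 1 / a ^ 2 := by positivity
  linarith

theorem radius_sq_eq {a b : ℝ} (hb : 0 < b) (hab : b < a) {t r : ℝ} {T : PlaneTriangle}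
    (hT : T ∈ interscribed a b (ellipsePoint a b (causticCenter a b t)) r) :
    r ^ 2 = causticRadiusSq a b t := by
  obtain ⟨hr, hlt, e, -⟩ := interscribed_vieta (hb.trans hab) hb hT
  exact radius_unique (one_div_sq_sub_pos hb hab) (one_div_sq_sub_lt hb hab).le (by positivity)
    (causticRadiusSq_pos hb hab t) hlt (causticRadiusSq_mul_lt hb hab t) e
    (cayley_causticCenter hb hab t)

/-! ### The locus of the nine-point centres. -/

/-- The direction of the locus of the nine-point centres. -/
noncomputable def eulerDirection (a b t : ℝ) : Plane :=
  !₂[-((a ^ 2 - b ^ 2) ^ 2 * Real.cos t / (4 * a * (a ^ 2 + 3 * b ^ 2))),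
    (a ^ 2 - b ^ 2) ^ 2 * Real.sin t / (4 * b * (3 * a ^ 2 + b ^ 2))]

/-- Vertex sum and circumcenter are real-linear in `μ`, and in the nine-point centre the
contributions of `μ.im` cancel. Hence the locus is a segment. -/
theorem eulerCenter_of_sums {a b : ℝ} (hb : 0 < b) (hab : b < a) {t : ℝ} {T : PlaneTriangle}
    {u v w μ : ℂ} (hu : Complex.normSq u = 1) (hv : Complex.normSq v = 1)
    (hw : Complex.normSq w = 1) (eu : T.points 0 = ellipsePoint a b u)
    (ev : T.points 1 = ellipsePoint a b v) (ew : T.points 2 = ellipsePoint a b w)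
    (hs : u + v + w = causticCenter a b t * (2 + μ)) (hl : u * v * w = μ * unitPoint t) :
    eulerCenter T = ellipsePoint a b (causticCenter a b t) +
      (1 - μ.re) • eulerDirection a b t := by
  have ha : 0 < a := hb.trans hab
  have h1 : a ^ 2 + 3 * b ^ 2 ≠ 0 := by positivity
  have h2 : 3 * a ^ 2 + b ^ 2 ≠ 0 := by positivity
  obtain ⟨c0, c1⟩ := circumcenter_of_inscribed ha.ne' hb.ne' hu hv hw eu ev ew
  have n0 := T.two_mul_eulerCenter 0
  have n1 := T.two_mul_eulerCenter 1
  rw [eu, ev, ew] at n0 n1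
  simp only [ellipsePoint_zero, ellipsePoint_one] at n0 n1
  rw [hs, hl] at c0 c1
  have r0 := congrArg Complex.re hs
  have r1 := congrArg Complex.im hs
  simp only [Complex.add_re, Complex.add_im, Complex.mul_re, Complex.mul_im, causticCenter,
    unitPoint, Complex.re_ofNat, Complex.im_ofNat] at c0 c1 r0 r1
  apply Plane.ext
  · have e : 8 * a * eulerCenter T 0 = 4 * a ^ 2 * (u.re + v.re + w.re) -
        4 * a * T.circumcenter 0 := by
      linear_combination 4 * a * n0
    apply mul_left_cancel₀ (by positivity : 8 * a ≠ 0)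
    rw [e, c0, r0]
    simp only [PiLp.add_apply, PiLp.smul_apply, smul_eq_mul, ellipsePoint_zero, eulerDirection,
      causticCenter, Matrix.cons_val]
    field
  · have e : 8 * b * eulerCenter T 1 = 4 * b ^ 2 * (u.im + v.im + w.im) -
        4 * b * T.circumcenter 1 := by
      linear_combination 4 * b * n1
    apply mul_left_cancel₀ (by positivity : 8 * b ≠ 0)
    rw [e, c1, r1]
    simp only [PiLp.add_apply, PiLp.smul_apply, smul_eq_mul, ellipsePoint_one, eulerDirection,
      causticCenter, Matrix.cons_val]
    field

/-- The nine-point centres of the family lie on a segment. -/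
theorem exists_eulerCenter_eq {a b : ℝ} (hb : 0 < b) (hab : b < a) {t r : ℝ} {T : PlaneTriangle}
    (hT : T ∈ interscribed a b (ellipsePoint a b (causticCenter a b t)) r) :
    ∃ s : ℝ, 0 ≤ s ∧ s ≤ 2 ∧ eulerCenter T = ellipsePoint a b (causticCenter a b t) +
      s • eulerDirection a b t := by
  have hr := radius_sq_eq hb hab hT
  obtain ⟨-, -, -, u, v, w, hu, hv, hw, eu, ev, ew, hs⟩ := interscribed_vieta (hb.trans hab) hb hT
  have hc := congrArg conj (causticCenter_sq_add hb hab t)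
  rw [map_add, map_pow, map_mul, Complex.conj_conj, Complex.conj_ofReal] at hc
  have h1 := BlaschkeTriple.mul_conj_eq_one (normSq_unitPoint t)
  have hμ : Complex.normSq (u * v * w * conj (unitPoint t)) = 1 := by
    simp only [Complex.normSq_mul, hu, hv, hw, Complex.normSq_conj, normSq_unitPoint, mul_one]
  rw [hr, hc] at hs
  have he := eulerCenter_of_sums hb hab (μ := u * v * w * conj (unitPoint t)) hu hv hw eu ev ew
    (by linear_combination hs) (by linear_combination -(u * v * w) * h1)
  have hre := Complex.abs_re_le_norm (u * v * w * conj (unitPoint t))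
  rw [Complex.normSq_eq_norm_sq, pow_eq_one_iff_of_nonneg (norm_nonneg _) two_ne_zero] at hμ
  rw [hμ, abs_le] at hre
  exact ⟨_, by linarith [hre.2], by linarith [hre.1], he⟩

theorem exists_foci {a b : ℝ} (hb : 0 < b) (hab : b < a) (t : ℝ) : ∃ f g : ℂ,
    Complex.normSq f < 1 ∧ Complex.normSq g < 1 ∧ f + g = 2 * causticCenter a b t ∧
    f * g = causticCenter a b t ^ 2 +
      ((causticRadiusSq a b t * (1 / b ^ 2 - 1 / a ^ 2) : ℝ) : ℂ) := by
  have hρ : √(causticRadiusSq a b t * (1 / b ^ 2 - 1 / a ^ 2)) ^ 2 =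
      causticRadiusSq a b t * (1 / b ^ 2 - 1 / a ^ 2) :=
    Real.sq_sqrt (mul_pos (causticRadiusSq_pos hb hab t) (one_div_sq_sub_pos hb hab)).le
  obtain ⟨hf, hg⟩ := normSq_focus_lt_one (one_div_sq_sub_lt hb hab) (causticRadiusSq_pos hb hab t)
    (causticRadiusSq_mul_lt hb hab t) hρ (cayley_causticCenter hb hab t)
  refine ⟨_, _, hf, hg, by ring, ?_⟩
  generalize √(causticRadiusSq a b t * (1 / b ^ 2 - 1 / a ^ 2)) = ρ at *
  rw [← hρ]
  push_cast
  linear_combination -(ρ : ℂ) ^ 2 * Complex.I_sq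

theorem exists_interscribed_of_triple {a b : ℝ} (hb : 0 < b) (hab : b < a) {t r : ℝ} (hr : 0 < r)
    (hr2 : r ^ 2 = causticRadiusSq a b t) {f g l u v w : ℂ}
    (hs : f + g = 2 * causticCenter a b t) (hp : f * g = causticCenter a b t ^ 2 +
      ((causticRadiusSq a b t * (1 / b ^ 2 - 1 / a ^ 2) : ℝ) : ℂ))
    (h : BlaschkeTriple f g l u v w) :
    ∃ T ∈ interscribed a b (ellipsePoint a b (causticCenter a b t)) r,
      T.points 0 = ellipsePoint a b u ∧
      T.points 1 = ellipsePoint a b v ∧ T.points 2 = ellipsePoint a b w := by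
  refine exists_interscribed (hb.trans hab) hb h hr hs (by rw [hp, hr2]) ?_
  have := cayley_causticCenter hb hab t
  rw [hp, map_add, map_pow, Complex.conj_ofReal, hr2]
  exact this

theorem isPonceletIncircle_caustic {a b : ℝ} (hb : 0 < b) (hab : b < a) {t r : ℝ} (hr : 0 < r)
    (hr2 : r ^ 2 = causticRadiusSq a b t) :
    IsPonceletIncircle a b (ellipsePoint a b (causticCenter a b t)) r := by
  intro V hV
  obtain ⟨u, hu, rfl⟩ := exists_of_mem_ellipse (hb.trans hab).ne' hb.ne' hV
  obtain ⟨f, g, hf, hg, hs, hp⟩ := exists_foci hb hab t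
  obtain ⟨l, v, w, -, h⟩ := BlaschkeTriple.exists_of_vertex hf hg hu
  obtain ⟨T, hT, e, -⟩ := exists_interscribed_of_triple hb hab hr hr2 hs hp h
  exact ⟨T, hT, 0, e⟩

/-- Every point of the segment is a nine-point centre of a triangle of the family. -/
theorem exists_interscribed_eulerCenter_eq {a b : ℝ} (hb : 0 < b) (hab : b < a) {t r : ℝ}
    (hr : 0 < r) (hr2 : r ^ 2 = causticRadiusSq a b t) {s : ℝ} (h0 : 0 ≤ s) (h2 : s ≤ 2) :
    ∃ T ∈ interscribed a b (ellipsePoint a b (causticCenter a b t)) r,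
      eulerCenter T = ellipsePoint a b (causticCenter a b t) + s • eulerDirection a b t := by
  obtain ⟨f, g, hf, hg, hs, hp⟩ := exists_foci hb hab t
  -- A unimodular number with `1 - μ.re = s`; it exists because `0 ≤ s ≤ 2`.
  set μ : ℂ := ⟨1 - s, √(1 - (1 - s) ^ 2)⟩ with hμ
  have hμ1 : Complex.normSq μ = 1 := by
    rw [Complex.normSq_apply, hμ]
    simp only
    rw [Real.mul_self_sqrt (by nlinarith)]
    ring
  obtain ⟨u, v, w, h⟩ := BlaschkeTriple.exists_of_prod (l := μ * unitPoint t) hf hg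
    (by rw [Complex.normSq_mul, hμ1, normSq_unitPoint, one_mul])
  obtain ⟨T, hT, eu, ev, ew⟩ := exists_interscribed_of_triple hb hab hr hr2 hs hp h
  have e := h.s₁
  rw [hp, causticCenter_sq_add hb hab, hs, map_mul, Complex.conj_conj] at e
  have h1 := BlaschkeTriple.mul_conj_eq_one (normSq_unitPoint t)
  have := eulerCenter_of_sums hb hab h.hu h.hv h.hw eu ev ew
    (by linear_combination e + μ * causticCenter a b t * h1) h.s₃
  refine ⟨T, hT, ?_⟩
  rw [this, hμ]
  simp

/-- Finds the multiple of the direction whose length is the inradius, hence the position of `X₁₁`.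
-/
theorem eulerDirection_smul_norm {a b : ℝ} (hb : 0 < b) (hab : b < a) (t : ℝ) :
    (8 * a ^ 2 * b ^ 2 / (a ^ 2 - b ^ 2) ^ 2 * eulerDirection a b t 0) ^ 2 +
      (8 * a ^ 2 * b ^ 2 / (a ^ 2 - b ^ 2) ^ 2 * eulerDirection a b t 1) ^ 2 =
    causticRadiusSq a b t := by
  have ha : 0 < a := hb.trans hab
  have h0 : a ^ 2 - b ^ 2 ≠ 0 := by nlinarith
  have h1 : a ^ 2 + 3 * b ^ 2 ≠ 0 := by positivity
  have h2 : 3 * a ^ 2 + b ^ 2 ≠ 0 := by positivity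
  simp only [eulerDirection, causticRadiusSq, Matrix.cons_val]
  field

theorem eulerDirection_ne_zero {a b : ℝ} (hb : 0 < b) (hab : b < a) (t : ℝ) :
    eulerDirection a b t ≠ 0 := by
  intro h
  have h1 := eulerDirection_smul_norm hb hab t
  have h2 := causticRadiusSq_pos hb hab t
  rw [h] at h1
  simp only [PiLp.zero_apply] at h1
  linarith

/-! ### The stationary points and the equilateral member. -/

theorem sbtw_add_sub_smul {C D : Plane} (hD : D ≠ 0) {s κ : ℝ} (hs : 0 < s) (hκ : 0 < κ) :
    Sbtw ℝ (C + s • D) C (C - κ • D) := by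
  rw [sbtw_iff_mem_image_Ioo_and_ne]
  refine ⟨⟨s / (s + κ), ⟨by positivity, (div_lt_one (by positivity)).2 (by linarith)⟩, ?_⟩, ?_⟩
  · have : (s + κ) ≠ 0 := by positivity
    ext i
    simp [AffineMap.lineMap_apply]
    field
  · intro h
    have h1 : (s + κ) • D = 0 := by
      have : (s + κ) • D = (C + s • D) - (C - κ • D) := by module
      rw [this, h, sub_self]
    exact (smul_ne_zero (by positivity) hD) h1

/-- The stationary Feuerbach point of the family. -/
theorem feuerbach_eq {a b : ℝ} (hb : 0 < b) (hab : b < a) (t : ℝ) :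
    ((a ^ 2 + b ^ 2) / (a ^ 2 - b ^ 2)) •
        (!₂[aTri a b * Real.cos t, -(bTri a b * Real.sin t)] : Plane) =
    ellipsePoint a b (causticCenter a b t) -
      (8 * a ^ 2 * b ^ 2 / (a ^ 2 - b ^ 2) ^ 2) • eulerDirection a b t := by
  have ha : 0 < a := hb.trans hab
  have h0 : a ^ 2 - b ^ 2 ≠ 0 := by nlinarith
  have h1 : a ^ 2 + 3 * b ^ 2 ≠ 0 := by positivity
  have h2 : 3 * a ^ 2 + b ^ 2 ≠ 0 := by positivity
  apply Plane.ext
  · simp only [PiLp.smul_apply, PiLp.sub_apply, smul_eq_mul, ellipsePoint_zero, causticCenter,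
      eulerDirection, Matrix.cons_val, aTri]
    field
  · simp only [PiLp.smul_apply, PiLp.sub_apply, smul_eq_mul, ellipsePoint_one, causticCenter,
      eulerDirection, Matrix.cons_val, bTri]
    field

/-- The multiplier is twice that of `feuerbach_eq`, as reflecting the centre in `X₁₁` requires. -/
theorem conj_point_eq {a b : ℝ} (hb : 0 < b) (hab : b < a) (t : ℝ) :
    (!₂[a * Real.cos t, -(b * Real.sin t)] : Plane) =
    ellipsePoint a b (causticCenter a b t) -
      (2 * (8 * a ^ 2 * b ^ 2 / (a ^ 2 - b ^ 2) ^ 2)) • eulerDirection a b t := by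
  have ha : 0 < a := hb.trans hab
  have h0 : a ^ 2 - b ^ 2 ≠ 0 := by nlinarith
  have h1 : a ^ 2 + 3 * b ^ 2 ≠ 0 := by positivity
  have h2 : 3 * a ^ 2 + b ^ 2 ≠ 0 := by positivity
  apply Plane.ext
  · simp only [PiLp.smul_apply, PiLp.sub_apply, smul_eq_mul, ellipsePoint_zero, causticCenter,
      eulerDirection, Matrix.cons_val]
    field
  · simp only [PiLp.smul_apply, PiLp.sub_apply, smul_eq_mul, ellipsePoint_one, causticCenter,
      eulerDirection, Matrix.cons_val]
    field

theorem centroid_mem_of_equilateral {a b : ℝ} (hb : 0 < b) (hab : b < a) {T : PlaneTriangle}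
    (hT : InscribedInEllipse a b T) (he : T.Equilateral) :
    ∃ t : ℝ, T.centroid = !₂[aTri a b * Real.cos t, bTri a b * Real.sin t] := by
  have ha : 0 < a := hb.trans hab
  obtain ⟨u, v, w, hu, hv, hw, -, -, -, eu, ev, ew⟩ := exists_of_inscribed ha.ne' hb.ne' hT
  obtain ⟨c0, c1⟩ := circumcenter_of_inscribed ha.ne' hb.ne' hu hv hw eu ev ew
  have g0 := T.three_mul_centroid 0
  have g1 := T.three_mul_centroid 1
  rw [← centroid_eq_circumcenter_of_equilateral T he] at c0 c1
  rw [eu, ev, ew] at g0 g1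
  simp only [ellipsePoint_zero, ellipsePoint_one] at g0 g1
  have hn : ‖u * v * w‖ = 1 := by
    rw [← pow_eq_one_iff_of_nonneg (norm_nonneg _) two_ne_zero, ← Complex.normSq_eq_norm_sq]
    simp only [Complex.normSq_mul, hu, hv, hw, mul_one]
  have hre := Complex.norm_mul_cos_arg (u * v * w)
  have him := Complex.norm_mul_sin_arg (u * v * w)
  rw [hn, one_mul] at hre him
  -- Eliminating `u + v + w` between the formulas for centroid and circumcenter leaves `u * v * w`,
  -- whose argument is the parameter; `4a² - 3c² = a² + 3b²` and `4b² + 3c² = 3a² + b²` are the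
  -- denominators.
  refine ⟨Complex.arg (u * v * w), ?_⟩
  rw [hre, him]
  have h1 : a ^ 2 + 3 * b ^ 2 ≠ 0 := by positivity
  have h2 : 3 * a ^ 2 + b ^ 2 ≠ 0 := by positivity
  simp only [Complex.add_re, Complex.add_im] at c0 c1
  apply Plane.ext
  · apply mul_left_cancel₀ h1
    simp only [Matrix.cons_val, aTri]
    rw [div_mul_eq_mul_div, mul_div_cancel₀ _ h1]
    linear_combination a * c0 - (a ^ 2 - b ^ 2) * g0
  · apply mul_left_cancel₀ h2
    simp only [Matrix.cons_val, bTri]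
    rw [div_mul_eq_mul_div, mul_div_cancel₀ _ h2]
    linear_combination b * c1 + (a ^ 2 - b ^ 2) * g1

theorem exists_equilateral_interscribed {a b : ℝ} (hb : 0 < b) (hab : b < a) {t r : ℝ}
    (hr : 0 < r) (hr2 : r ^ 2 = causticRadiusSq a b t) :
    ∃ T ∈ interscribed a b (ellipsePoint a b (causticCenter a b t)) r, T.Equilateral := by
  obtain ⟨T, hT, he⟩ := exists_interscribed_eulerCenter_eq hb hab hr hr2 le_rfl zero_le_two
  refine ⟨T, hT, T.equilateral_of_eulerCenter_eq ?_⟩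
  rw [he, hT.2.1, zero_smul, add_zero]

theorem feuerbachPoint_of_interscribed {a b : ℝ} (hb : 0 < b) (hab : b < a) {t r : ℝ}
    {T : PlaneTriangle}
    (hT : T ∈ interscribed a b (ellipsePoint a b (causticCenter a b t)) r) (h : ¬ T.Equilateral) :
    feuerbachPoint T = ellipsePoint a b (causticCenter a b t) -
      (8 * a ^ 2 * b ^ 2 / (a ^ 2 - b ^ 2) ^ 2) • eulerDirection a b t := by
  have ha : 0 < a := hb.trans hab
  have hc : 0 < a ^ 2 - b ^ 2 := by nlinarith
  obtain ⟨⟨ν, hν, hF⟩, hn⟩ := T.feuerbachPoint_sub h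
  obtain ⟨s, h0, -, hs⟩ := exists_eulerCenter_eq hb hab hT
  have hpos : 0 < s := by
    refine lt_of_le_of_ne h0 ?_
    rintro rfl
    exact h (T.equilateral_of_eulerCenter_eq (by rw [hs, hT.2.1, zero_smul, add_zero]))
  have hD := eulerDirection_smul_norm hb hab t
  have hR := causticRadiusSq_pos hb hab t
  rw [hT.2.2, radius_sq_eq hb hab hT, hF, hF, hs, hT.2.1, ← hD] at hn
  rw [← hD] at hR
  simp only [hs, hT.2.1, PiLp.add_apply, PiLp.smul_apply, smul_eq_mul, add_sub_cancel_left] at hF hn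
  set κ := 8 * a ^ 2 * b ^ 2 / (a ^ 2 - b ^ 2) ^ 2 with hκ
  have hκ0 : 0 < κ := by positivity
  have hne : eulerDirection a b t 0 ^ 2 + eulerDirection a b t 1 ^ 2 ≠ 0 := by
    intro h0
    have : (κ * eulerDirection a b t 0) ^ 2 + (κ * eulerDirection a b t 1) ^ 2 = 0 := by
      linear_combination κ ^ 2 * h0
    linarith
  -- Both `ν * s` and `κ` scale the direction to length the inradius, and both are positive.
  have hsq : (ν * s) ^ 2 = κ ^ 2 := by
    apply mul_right_cancel₀ hne
    linear_combination hn
  have heq : ν * s = κ := (pow_left_inj₀ (by positivity) hκ0.le two_ne_zero).1 hsq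
  have key : ∀ k, feuerbachPoint T k = (ellipsePoint a b (causticCenter a b t) -
      κ • eulerDirection a b t) k := by
    intro k
    simp only [PiLp.sub_apply, PiLp.smul_apply, smul_eq_mul]
    linear_combination hF k - eulerDirection a b t k * heq
  exact Plane.ext (key 0) (key 1)

/-! ### Assembly of the theorem. -/

theorem mainTheorem4 (a b : ℝ) (hb : 0 < b) (hab : b < a) :
    -- the locus of centroids of inscribed equilaterals
    equilateralCentroidLocus a b =
      {C : Plane | ∃ t : ℝ, C = !₂[aTri a b * Real.cos t, bTri a b * Real.sin t]} ∧
    ∀ (t : ℝ) (C P Z : Plane),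
      C = !₂[aTri a b * Real.cos t, bTri a b * Real.sin t] →
      P = ((a ^ 2 + b ^ 2) / (a ^ 2 - b ^ 2)) •
        (!₂[aTri a b * Real.cos t, -(bTri a b * Real.sin t)] : Plane) →
      Z = !₂[a * Real.cos t, -(b * Real.sin t)] →
      -- there is a Poncelet family about a circle centred at `C`
      (∃ r : ℝ, IsPonceletIncircle a b C r) ∧
      ∀ r : ℝ, IsPonceletIncircle a b C r →
        -- the family contains an equilateral
        (∃ T ∈ interscribed a b C r, T.Equilateral) ∧
        -- `X₁₁` and `X₈₀` are stationary over the family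
        (∀ T ∈ interscribed a b C r, ¬ T.Equilateral →
          feuerbachPoint T = P ∧ centerX80 T = Z) ∧
        -- on the incircle and on the ellipse, respectively
        P ∈ Metric.sphere C r ∧ Z ∈ ellipse a b ∧
        -- the locus of `X₅` is a segment with endpoint `C`; the two points lie on its
        -- extension beyond `C`
        ∃ F : Plane, F ≠ C ∧ eulerCenter '' interscribed a b C r = segment ℝ C F ∧
          Sbtw ℝ F C P ∧ Sbtw ℝ F C Z := by
  have ha : 0 < a := hb.trans hab
  have hc : 0 < a ^ 2 - b ^ 2 := by nlinarith
  refine ⟨?_, ?_⟩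
  · ext p
    simp only [equilateralCentroidLocus, Set.mem_ofPred_eq]
    constructor
    · rintro ⟨T, hT, he, rfl⟩
      exact centroid_mem_of_equilateral hb hab hT he
    · rintro ⟨t, rfl⟩
      have hR := causticRadiusSq_pos hb hab t
      obtain ⟨T, hT, he⟩ := exists_equilateral_interscribed hb hab (t := t)
        (Real.sqrt_pos.2 hR) (Real.sq_sqrt hR.le)
      refine ⟨T, hT.1, he, ?_⟩
      rw [centroid_eq_incenter_of_equilateral T he, hT.2.1, ellipsePoint_causticCenter]
  intro t C P Z hC hP hZ
  rw [← ellipsePoint_causticCenter] at hC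
  have hZ' := hZ
  rw [conj_point_eq hb hab] at hZ
  rw [feuerbach_eq hb hab] at hP
  have hR := causticRadiusSq_pos hb hab t
  have hD := eulerDirection_ne_zero hb hab t
  have hκ : 0 < 8 * a ^ 2 * b ^ 2 / (a ^ 2 - b ^ 2) ^ 2 := by positivity
  have hnorm := eulerDirection_smul_norm hb hab t
  subst hC
  refine ⟨⟨√(causticRadiusSq a b t), isPonceletIncircle_caustic hb hab (Real.sqrt_pos.2 hR)
    (Real.sq_sqrt hR.le)⟩, ?_⟩
  intro r hPon
  -- Any one triangle of the family determines `r`; the vertex `(a, 0)` is an arbitrary choice.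
  obtain ⟨T₀, hT₀, -⟩ := hPon (ellipsePoint a b 1)
    ((ellipsePoint_mem_iff ha.ne' hb.ne').2 (by simp))
  have hr2 := radius_sq_eq hb hab hT₀
  have hr : 0 < r := hT₀.2.2 ▸ T₀.inradius_pos
  refine ⟨exists_equilateral_interscribed hb hab hr hr2, ?_, ?_, ?_, ?_⟩
  · intro T hT he
    have hF := feuerbachPoint_of_interscribed hb hab hT he
    refine ⟨hF.trans hP.symm, ?_⟩
    rw [centerX80, hF, hT.2.1, hZ, AffineEquiv.pointReflection_apply, vsub_eq_sub, vadd_eq_add]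
    module
  · rw [mem_sphere_iff_norm, ← sq_eq_sq₀ (norm_nonneg _) hr.le, EuclideanSpace.norm_sq_eq, hr2,
      ← hnorm, hP]
    simp [Fin.sum_univ_two, mul_pow, sq_abs]
  · rw [hZ']
    have : (!₂[a * Real.cos t, -(b * Real.sin t)] : Plane) =
        ellipsePoint a b (conj (unitPoint t)) := by
      simp [ellipsePoint, unitPoint]
    rw [this, ellipsePoint_mem_iff ha.ne' hb.ne', Complex.normSq_conj, normSq_unitPoint]
  · refine ⟨ellipsePoint a b (causticCenter a b t) + (2 : ℝ) • eulerDirection a b t, ?_, ?_, ?_, ?_⟩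
    · simpa using hD
    · rw [segment_eq_image']
      ext p
      simp only [Set.mem_image, Set.mem_Icc, add_sub_cancel_left, smul_smul]
      constructor
      · rintro ⟨T, hT, rfl⟩
        obtain ⟨s, h0, h2, hs⟩ := exists_eulerCenter_eq hb hab hT
        exact ⟨s / 2, ⟨by linarith, by linarith⟩, by rw [hs, div_mul_cancel₀ _ two_ne_zero]⟩
      · rintro ⟨s, ⟨h0, h1⟩, rfl⟩
        exact exists_interscribed_eulerCenter_eq hb hab hr hr2 (by linarith) (by linarith)
    · rw [hP]
      exact sbtw_add_sub_smul hD two_pos hκ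
    · rw [hZ]
      exact sbtw_add_sub_smul hD two_pos (by positivity)
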